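/- Let $a\in(0,1)$, $\varepsilon_1\in(0,1)$, $\varepsilon_2>0$, and let $Y$ be a random variable whose distribution $\eta$ is absolutely continuous, carried by $(1-\varepsilon_1,1+\varepsilon_2)$, has a bounded density, and satisfies $\mathbb E[\log Y]=0$. Let $\lambda_1,\lambda_2,\dots$ be random variables with $P(\lambda_i=1-a)=P(\lambda_i=1+a)=\tfrac12$, and let $Y_1,Y_2,\dots$ have distribution $\eta$, where all of the variables $\lambda_1,\lambda_2,\dots,Y_1,Y_2,\dots$ are mutually independent. Put $Z_i=\lambda_iY_i$ and $$X=1+Z_1+Z_1Z_2+\cdots+Z_1Z_2\cdots Z_n+\cdots .$$ This series converges almost surely. Let $\nu^a_{\mathbf y}$ be the (regular) conditional distribution of $X$ given $(Y_1,Y_2,\dots)=\mathbf y=(y_1,y_2,\dots)$. Let $\mathcal L$ be Lebesgue measure on $\mathbb R$, and for a measure $\nu$ on $\mathbb R$ let $\dim_H(\nu)=\inf\{\dim_H(S): S\subseteq\mathbb R,\ \nu(\mathbb R\setminus S)=0\}$, where $\dim_H(S)$ is the Hausdorff dimension of $S$. "For a.e. $\mathbf y$" refers to the product measure $\eta^{\mathbb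 N}$, the distribution of $(Y_1,Y_2,\dots)$. (a) If $0<a<\sqrt3/2$, then $\nu^a_{\mathbf y}\ll\mathcal L$ for a.e. $\mathbf y$. (b) If $\sqrt3/2\le a<1$, then, for a.e. $\mathbf y$, $\nu^a_{\mathbf y}\perp\mathcal L$ and $$\dim_H(\nu^a_{\mathbf y})=\frac{2\log 2}{\log\frac1{1-a^2}}.$$ -/

import Mathlib

open MeasureTheory ProbabilityTheory
open scoped ENNReal NNReal

/-- The Hausdorff dimension of a measure `ν` on the real line: the infimum of the Hausdorff
dimensions of the sets whose complement is `ν`-null. -/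
noncomputable def measureDimH (ν : Measure ℝ) : ℝ≥0∞ :=
  ⨅ (s : Set ℝ) (_ : ν sᶜ = 0), dimH s

/-- The `n`-th term `Z₁ Z₂ ⋯ Zₙ` of the random series (indices shifted to start at `0`; the
empty product for `n = 0` is `1`). -/
noncomputable def seriesTerm {Ω : Type*} (Z : ℕ → Ω → ℝ) (n : ℕ) (ω : Ω) : ℝ :=
  ∏ i ∈ Finset.range n, Z i ω

/-- The random series `X = 1 + Z₁ + Z₁ Z₂ + Z₁ Z₂ Z₃ + ⋯`. -/
noncomputable def seriesSum {Ω : Type*} (Z : ℕ → Ω → ℝ) (ω : Ω) : ℝ :=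
  ∑' n : ℕ, seriesTerm Z n ω

/-- The law of a fair choice between the two numbers `1 - a` and `1 + a`. -/
noncomputable def fairChoice (a : ℝ) : Measure ℝ :=
  (2⁻¹ : ℝ≥0∞) • Measure.dirac (1 - a) + (2⁻¹ : ℝ≥0∞) • Measure.dirac (1 + a)

/-- `η` is an absolutely continuous law carried by `(1 - ε₁, 1 + ε₂)`, with bounded density, and
with vanishing logarithmic mean. (For `ε₁ < 1` the logarithm is bounded on this interval, so the
integral is a genuine one.) -/
structure IsErrorLaw (η : Measure ℝ) (ε₁ ε₂ : ℝ) : Prop where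
  isProbabilityMeasure : IsProbabilityMeasure η
  absolutelyContinuous : η ≪ volume
  carried : η (Set.Ioo (1 - ε₁) (1 + ε₂))ᶜ = 0
  bounded_density : ∃ C : ℝ≥0, ∀ᵐ x ∂(volume : Measure ℝ), η.rnDeriv volume x ≤ C
  log_mean : ∫ x, Real.log x ∂η = 0

/-- The conditional distribution (a regular version) of the series with factors
`Zᵢ = lamᵢ Yᵢ`, given the sequence of errors `(Y₁, Y₂, …) = y`. -/
noncomputable def condSeriesLaw {Ω : Type*} [MeasurableSpace Ω] (P : Measure Ω)
    [IsFiniteMeasure P] (lam Y : ℕ → Ω → ℝ) (y : ℕ → ℝ) : Measure ℝ :=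
  condDistrib (seriesSum fun i ω => lam i ω * Y i ω) (fun ω i => Y i ω) P y

/-! Model the choices by fair coin tosses `u`. By independence, the conditional law of the series
given the errors `y` is `quenchedLaw a y`, the law of the sum under `u` with `y` frozen
(`condSeriesLaw_ae_eq`). By the strong law, the product `P_n` of the first `n` factors satisfies
`log P_n / n → L = log (1 - a^2) / 2` almost surely, since the errors have logarithmic mean zero.
There are `2^n` words of length `n`, each placing its mass `2^(-n)` on a piece of size about `exp (n
* L)`; the critical case `2 * exp L = 1` is `a = √3 / 2`.

Regularity comes from transversality (`measure_closePairs_le`). If two toss sequences first differ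
at `n`, the difference of their sums is `P_n * y_n * (d + t * V)`, where `t` is the error with index
`n + 1`, `|d| = 2 * a`, and `V` does not involve `t`. A small value forces a slope `V` that is not
small, so the bounded density gives probability `O(ρ / P_n)` to a difference of size at most `ρ`.
Summing over `n` with weights `2^(-n)` bounds the mean mass of a `ρ`-ball about the random sum by `K
* ρ^s` whenever `2 * exp (L * s) > 1` and `s ≤ 1` (`lintegral_quenchedLaw_closedBall_le`). Taking `s
= 1` gives absolute continuity below the threshold; above it, `s` close to `log 2 / (-L)` gives the
lower dimension bound. Covering by the `2^n` word intervals gives the upper one.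

Singularity has to include the critical case, where the dimension is 1. There `log (2^n * P_n)` is a
centred nondegenerate random walk, and in general its drift is nonpositive, so `2^n * P_n` takes
arbitrarily small values. Stop at the first `n` with `2^n * P_n ≤ ε`. The stopped words have total
weight at most 1, so intervals of length `P_n * K` attached to them have total length at most `ε *
K`. The tail of the series after stopping is a fresh copy of the whole, hence rarely above `K`.
Borel–Cantelli then produces a null set carrying the law (`ae_quenchedLaw_mutuallySingular`). -/

/-! ### Infinite product measures: pairing, resampling, restarting -/

section ProductTools
open Set

/-- The law of a fair coin. -/
noncomputable def coin : Measure Bool :=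
  (2⁻¹ : ℝ≥0∞) • Measure.dirac false + (2⁻¹ : ℝ≥0∞) • Measure.dirac true

instance : IsProbabilityMeasure coin := ⟨by simp [coin, ENNReal.inv_two_add_inv_two]⟩

lemma coin_singleton (b : Bool) : coin {b} = 2⁻¹ := by
  cases b <;> simp [coin]

variable {α β : Type*} [MeasurableSpace α] [MeasurableSpace β]

/-- A law on pairs of sequences which has product values on finite boxes is a product law. -/
lemma prod_infinitePi_eq_of_boxes (p : Measure α) (q : Measure β) [IsProbabilityMeasure p]
    [IsProbabilityMeasure q] (μ : Measure ((ℕ → α) × (ℕ → β)))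
    (h : ∀ (I : Finset ℕ) (s : ℕ → Set α) (t : ℕ → Set β), (∀ i, MeasurableSet (s i)) →
      (∀ i, MeasurableSet (t i)) →
      μ ((Set.pi I s) ×ˢ (Set.pi I t)) = (∏ i ∈ I, p (s i)) * ∏ i ∈ I, q (t i)) :
    (Measure.infinitePi fun _ : ℕ => p).prod (Measure.infinitePi fun _ : ℕ => q) = μ := by
  refine Measure.prod_eq_generateFrom
    (C := squareCylinders fun _ => {s | MeasurableSet s})
    (D := squareCylinders fun _ => {s | MeasurableSet s})
    generateFrom_squareCylinders generateFrom_squareCylinders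
    (isPiSystem_squareCylinders (fun _ => MeasurableSpace.isPiSystem_measurableSet)
      fun _ => MeasurableSet.univ)
    (isPiSystem_squareCylinders (fun _ => MeasurableSpace.isPiSystem_measurableSet)
      fun _ => MeasurableSet.univ)
    ⟨fun _ => univ, fun _ => ⟨∅, fun _ => univ, by simp, by simp⟩, fun _ => by simp,
      by simp [iUnion_const]⟩
    ⟨fun _ => univ, fun _ => ⟨∅, fun _ => univ, by simp, by simp⟩, fun _ => by simp,
      by simp [iUnion_const]⟩ ?_
  rintro _ ⟨I, s, hs, rfl⟩ _ ⟨J, t, ht, rfl⟩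
  have hs' : ∀ i, MeasurableSet (s i) := fun i => hs i (mem_univ i)
  have ht' : ∀ i, MeasurableSet (t i) := fun i => ht i (mem_univ i)
  have key := h (I ∪ J) (fun i => if i ∈ I then s i else univ)
    (fun i => if i ∈ J then t i else univ)
    (fun i => by split_ifs; exacts [hs' i, MeasurableSet.univ])
    (fun i => by split_ifs; exacts [ht' i, MeasurableSet.univ])
  have e1 : (Set.pi (I ∪ J : Finset ℕ) fun i => if i ∈ I then s i else univ) = Set.pi I s := by
    ext x
    simp only [Set.mem_pi, SetLike.mem_coe, Finset.mem_union]
    constructor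
    · intro hx i hi
      simpa [hi] using hx i (Or.inl hi)
    · intro hx i _
      split_ifs with hi
      exacts [hx i hi, mem_univ _]
  have e2 : (Set.pi (I ∪ J : Finset ℕ) fun i => if i ∈ J then t i else univ) = Set.pi J t := by
    ext x
    simp only [Set.mem_pi, SetLike.mem_coe, Finset.mem_union]
    constructor
    · intro hx i hi
      simpa [hi] using hx i (Or.inr hi)
    · intro hx i _
      split_ifs with hi
      exacts [hx i hi, mem_univ _]
  rw [e1, e2] at key
  rw [key, Measure.infinitePi_pi _ fun i _ => hs' i, Measure.infinitePi_pi _ fun i _ => ht' i]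
  congr 1
  · rw [← Finset.prod_subset (Finset.subset_union_left (s₂ := J))]
    · exact Finset.prod_congr rfl fun i hi => by simp [hi]
    · intro i _ hi; simp [hi]
  · rw [← Finset.prod_subset (Finset.subset_union_right (s₁ := I))]
    · exact Finset.prod_congr rfl fun i hi => by simp [hi]
    · intro i _ hi; simp [hi]

/-- A sequence of pairs as a pair of sequences. -/
def unzipSeq (α β : Type*) [MeasurableSpace α] [MeasurableSpace β] :
    (ℕ → α × β) ≃ᵐ (ℕ → α) × (ℕ → β) where
  toEquiv := Equiv.arrowProdEquivProdArrow ℕ (fun _ => α) (fun _ => β)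
  measurable_toFun := by
    simp only [Equiv.arrowProdEquivProdArrow]
    dsimp
    fun_prop
  measurable_invFun := by
    simp only [Equiv.arrowProdEquivProdArrow]
    dsimp
    fun_prop

/-- Lets toss and error at one time act as a single i.i.d. step, as the random walk and the
restarting argument require. -/
lemma map_unzipSeq (p : Measure α) (q : Measure β) [IsProbabilityMeasure p]
    [IsProbabilityMeasure q] :
    (Measure.infinitePi fun _ : ℕ => p.prod q).map (unzipSeq α β) =
      (Measure.infinitePi fun _ : ℕ => p).prod (Measure.infinitePi fun _ : ℕ => q) := by
  refine (prod_infinitePi_eq_of_boxes p q _ fun I s t hs ht => ?_).symm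
  rw [MeasurableEquiv.map_apply]
  have : (unzipSeq α β) ⁻¹' ((Set.pi I s) ×ˢ (Set.pi I t)) = Set.pi I fun i => s i ×ˢ t i := by
    ext x
    simp [unzipSeq, Equiv.arrowProdEquivProdArrow, forall_and]
  rw [this, Measure.infinitePi_pi _ fun i _ => (hs i).prod (ht i)]
  simp only [Measure.prod_prod, Finset.prod_mul_distrib]

/-- Resampling one coordinate preserves a product law. -/
lemma map_update_infinitePi (q : Measure β) [IsProbabilityMeasure q] (k : ℕ) :
    ((Measure.infinitePi fun _ : ℕ => q).prod q).map
      (fun x : (ℕ → β) × β => Function.update x.1 k x.2) = Measure.infinitePi fun _ : ℕ => q := by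
  refine Measure.eq_infinitePi _ fun s t ht => ?_
  have hm : Measurable fun x : (ℕ → β) × β => Function.update x.1 k x.2 := by
    refine measurable_pi_iff.2 fun i => ?_
    by_cases hi : i = k
    · subst hi; simpa using measurable_snd
    · simp only [Function.update_of_ne hi]; fun_prop
  rw [Measure.map_apply hm (MeasurableSet.pi s.countable_toSet fun i _ => ht i)]
  by_cases hk : k ∈ s
  · have : (fun x : (ℕ → β) × β => Function.update x.1 k x.2) ⁻¹' (Set.pi s t) =
        (Set.pi (s.erase k : Finset ℕ) t) ×ˢ t k := by
      ext ⟨x, b⟩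
      simp only [mem_preimage, Set.mem_pi, mem_prod, Finset.coe_erase, mem_sdiff, SetLike.mem_coe,
        mem_singleton_iff]
      constructor
      · intro h
        refine ⟨fun i hi => ?_, ?_⟩
        · have := h i hi.1
          rwa [Function.update_of_ne hi.2] at this
        · have := h k hk
          rwa [Function.update_self] at this
      · rintro ⟨h1, h2⟩ i hi
        by_cases hik : i = k
        · subst hik; rwa [Function.update_self]
        · rw [Function.update_of_ne hik]; exact h1 i ⟨hi, hik⟩
    rw [this, Measure.prod_prod, Measure.infinitePi_pi _ fun i _ => ht i, mul_comm,
      Finset.mul_prod_erase s (fun i => q (t i)) hk]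
  · have : (fun x : (ℕ → β) × β => Function.update x.1 k x.2) ⁻¹' (Set.pi s t) =
        (Set.pi s t) ×ˢ univ := by
      ext ⟨x, b⟩
      simp only [mem_preimage, Set.mem_pi, mem_prod, SetLike.mem_coe, mem_univ, and_true]
      refine forall₂_congr fun i hi => ?_
      rw [Function.update_of_ne]
      rintro rfl
      exact hk hi
    rw [this, Measure.prod_prod, Measure.infinitePi_pi _ fun i _ => ht i]
    simp

/-- The sequence which follows `x` up to time `n` and then runs through `x'`. -/
def concatSeq {γ : Type*} (n : ℕ) (x x' : ℕ → γ) (i : ℕ) : γ := if i < n then x i else x' (i - n)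

lemma measurable_concatSeq (n : ℕ) :
    Measurable fun x : (ℕ → β) × (ℕ → β) => concatSeq n x.1 x.2 := by
  refine measurable_pi_iff.2 fun i => ?_
  by_cases hi : i < n
  · simp only [concatSeq, hi, if_true]; fun_prop
  · simp only [concatSeq, hi, if_false]; fun_prop

/-- Restarting an independent copy at time `n` preserves a product law. -/
lemma map_concatSeq_infinitePi (q : Measure β) [IsProbabilityMeasure q] (n : ℕ) :
    ((Measure.infinitePi fun _ : ℕ => q).prod (Measure.infinitePi fun _ : ℕ => q)).map
      (fun x : (ℕ → β) × (ℕ → β) => concatSeq n x.1 x.2) = Measure.infinitePi fun _ : ℕ => q := by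
  refine Measure.eq_infinitePi _ fun s t ht => ?_
  rw [Measure.map_apply (measurable_concatSeq n)
    (MeasurableSet.pi s.countable_toSet fun i _ => ht i)]
  have : (fun x : (ℕ → β) × (ℕ → β) => concatSeq n x.1 x.2) ⁻¹' (Set.pi s t) =
      (Set.pi (s.filter (· < n) : Finset ℕ) t) ×ˢ
        (Set.pi ((s.filter (¬ · < n)).image (· - n) : Finset ℕ) fun i => t (i + n)) := by
    ext ⟨x, x'⟩
    simp only [mem_preimage, Set.mem_pi, mem_prod, SetLike.mem_coe, concatSeq, Finset.mem_image,
      Finset.mem_filter]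
    constructor
    · intro h
      refine ⟨fun i hi => by simpa [hi.2] using h i hi.1, ?_⟩
      rintro _ ⟨j, hj, rfl⟩
      have := h j hj.1
      rw [if_neg hj.2] at this
      rwa [Nat.sub_add_cancel (not_lt.1 hj.2)]
    · rintro ⟨h1, h2⟩ i hi
      split_ifs with hin
      · exact h1 i ⟨hi, hin⟩
      · have := h2 (i - n) ⟨i, ⟨hi, hin⟩, rfl⟩
        rwa [Nat.sub_add_cancel (not_lt.1 hin)] at this
  rw [this, Measure.prod_prod, Measure.infinitePi_pi _ fun i _ => ht i,
    Measure.infinitePi_pi _ fun i _ => ht (i + n), Finset.prod_image,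
    ← Finset.prod_filter_mul_prod_filter_not s (· < n) (fun i => q (t i))]
  · congr 1
    refine Finset.prod_congr rfl fun i hi => ?_
    rw [Nat.sub_add_cancel (not_lt.1 (Finset.mem_filter.1 hi).2)]
  · intro i hi j hj hij
    have h1 := (Finset.mem_filter.1 hi).2
    have h2 := (Finset.mem_filter.1 hj).2
    simp only at hij
    omega

end ProductTools

/-! ### Local densities: absolute continuity and Hausdorff dimension -/

section Densities
open Set Filter Topology Metric

lemma measurable_measure_closedBall (ν : Measure ℝ) [IsFiniteMeasure ν] (r : ℝ) :
    Measurable fun x => ν (closedBall x r) := by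
  have hm : MeasurableSet {z : ℝ × ℝ | dist z.2 z.1 ≤ r} :=
    measurableSet_le (by fun_prop) measurable_const
  exact measurable_measure_prodMk_left hm

/-- A finite measure whose lower density is finite almost everywhere is absolutely continuous. -/
lemma absolutelyContinuous_of_liminf (ν : Measure ℝ) [IsFiniteMeasure ν]
    (h : ∀ᵐ x ∂ν, liminf (fun k : ℕ => 2 ^ k * ν (closedBall x ((1 / 2) ^ k))) atTop < ∞) :
    ν ≪ volume := by
  refine Measure.AbsolutelyContinuous.mk fun N hN hN0 => ?_
  -- Lebesgue measure is differentiated with respect to `ν`: the derivative vanishes `ν`-a.e. on the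
  -- null set `N`, so volume over `ν`-mass of balls tends to 0 there. A finite lower density keeps
  -- this ratio at least `2 / C` along infinitely many dyadic radii.
  have hz : ∀ᵐ x ∂ν, x ∈ N → (volume : Measure ℝ).rnDeriv ν x = 0 := by
    have h1 : ∫⁻ x in N, (volume : Measure ℝ).rnDeriv ν x ∂ν = 0 :=
      le_antisymm ((Measure.setLIntegral_rnDeriv_le N).trans hN0.le) zero_le
    rw [lintegral_eq_zero_iff (Measure.measurable_rnDeriv _ _)] at h1
    exact (ae_restrict_iff' hN).1 h1
  have hr : Tendsto (fun k : ℕ => ((1 : ℝ) / 2) ^ k) atTop (𝓝[>] 0) :=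
    tendsto_nhdsWithin_iff.2 ⟨tendsto_pow_atTop_nhds_zero_of_lt_one (by norm_num) (by norm_num),
      Eventually.of_forall fun k => by simp⟩
  have : ∀ᵐ x ∂ν, x ∉ N := by
    filter_upwards [h, hz, Besicovitch.ae_tendsto_rnDeriv (volume : Measure ℝ) ν] with x h1 h2 h3 hx
    rw [h2 hx] at h3
    have h4 := h3.comp hr
    obtain ⟨C, hC1, hC2⟩ := exists_between h1
    have hfr := frequently_lt_of_liminf_lt (by isBoundedDefault) hC1
    have hpos : (0 : ℝ≥0∞) < 2 / C := ENNReal.div_pos (by norm_num) hC2.ne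
    obtain ⟨k, hk1, hk2⟩ := (hfr.and_eventually (h4.eventually (gt_mem_nhds hpos))).exists
    refine absurd hk2 (not_lt.2 ?_)
    simp only [Function.comp, Real.volume_closedBall]
    have e : ENNReal.ofReal (2 * (1 / 2) ^ k) = 2 / 2 ^ k := by
      rw [ENNReal.ofReal_mul (by norm_num), ENNReal.ofReal_pow (by norm_num),
        ENNReal.ofReal_div_of_pos (by norm_num)]
      simp [ENNReal.inv_pow, div_eq_mul_inv]
    rw [e, ENNReal.div_eq_inv_mul (a := 2 / 2 ^ k), ENNReal.div_eq_inv_mul (b := 2 ^ k),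
      ← mul_assoc, ← ENNReal.mul_inv (by simp) (by simp), ENNReal.div_eq_inv_mul]
    gcongr
    rw [mul_comm]
    exact hk1.le
  simpa [ae_iff] using this

/-- The mass distribution principle. -/
lemma le_measureDimH (ν : Measure ℝ) [IsProbabilityMeasure ν] (s : ℝ≥0) (hs : 0 < s)
    (h : ∀ᵐ x ∂ν, ∃ C : ℝ≥0, ∀ k : ℕ,
      ν (closedBall x ((1 / 2) ^ k)) ≤ C * ENNReal.ofReal ((1 / 2) ^ k) ^ (s : ℝ)) :
    (s : ℝ≥0∞) ≤ measureDimH ν := by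
  have hs' : (0 : ℝ) < s := hs
  let E : ℕ → Set ℝ := fun j => {x | ∀ k : ℕ,
      ν (closedBall x ((1 / 2) ^ k)) ≤ j * ENNReal.ofReal ((1 / 2) ^ k) ^ (s : ℝ)}
  have hE : ∀ j, MeasurableSet (E j) := fun j => by
    have : E j = ⋂ k : ℕ, {x | ν (closedBall x ((1 / 2) ^ k)) ≤
      j * ENNReal.ofReal ((1 / 2) ^ k) ^ (s : ℝ)} := by ext; simp [E]
    rw [this]
    exact MeasurableSet.iInter fun k =>
      measurableSet_le (measurable_measure_closedBall ν _) measurable_const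
  have hlim : Tendsto (fun k : ℕ => ENNReal.ofReal (((1 : ℝ) / 2) ^ k) ^ (s : ℝ)) atTop (𝓝 0) := by
    have h1 : Tendsto (fun k : ℕ => ENNReal.ofReal (((1 : ℝ) / 2) ^ k)) atTop (𝓝 0) := by
      simpa using ENNReal.tendsto_ofReal
        (tendsto_pow_atTop_nhds_zero_of_lt_one (r := (1 : ℝ) / 2) (by norm_num) (by norm_num))
    have := h1.ennrpow_const (s : ℝ)
    rwa [ENNReal.zero_rpow_of_pos hs'] at this
  have hle : ∀ j : ℕ, ν.restrict (E j) ≪ (Measure.hausdorffMeasure (s : ℝ) : Measure ℝ) := by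
    intro j
    -- The factor `2 ^ s` pays for rounding a diameter up to a dyadic scale; `j + 1` in place of `j`
    -- keeps `c` nonzero.
    set c : ℝ≥0∞ := (j + 1) * 2 ^ (s : ℝ) with hc
    have hc0 : c ≠ 0 := by simp [hc]
    have hct : c ≠ ∞ := ENNReal.mul_ne_top (by simp) (by simp)
    have hmain : c⁻¹ • ν.restrict (E j) ≤ Measure.hausdorffMeasure (s : ℝ) := by
      refine Measure.le_hausdorffMeasure _ _ 1 one_pos fun t ht => ?_
      rw [Measure.smul_apply, smul_eq_mul, Measure.restrict_apply' (hE j)]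
      rw [← ENNReal.div_eq_inv_mul, ENNReal.div_le_iff hc0 hct]
      rcases (t ∩ E j).eq_empty_or_nonempty with he | ⟨x, hxt, hxE⟩
      · simp [he]
      have hsub : ∀ k : ℕ, ediam t ≤ ENNReal.ofReal ((1 / 2) ^ k) →
          ν (t ∩ E j) ≤ (j + 1) * ENNReal.ofReal ((1 / 2) ^ k) ^ (s : ℝ) := by
        intro k hk
        calc ν (t ∩ E j) ≤ ν (closedBall x ((1 / 2) ^ k)) := by
              refine measure_mono fun y hy => ?_
              rw [mem_closedBall, ← ENNReal.ofReal_le_ofReal_iff (by positivity), ← edist_dist]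
              exact (edist_le_ediam_of_mem hy.1 hxt).trans hk
          _ ≤ j * ENNReal.ofReal ((1 / 2) ^ k) ^ (s : ℝ) := hxE k
          _ ≤ _ := by gcongr; exact le_self_add
      rcases eq_or_ne (ediam t) 0 with h0 | h0
      · have : ν (t ∩ E j) ≤ 0 := by
          have h2 := ENNReal.Tendsto.const_mul (a := (j + 1 : ℝ≥0∞)) hlim (Or.inr (by simp))
          rw [mul_zero] at h2
          exact ge_of_tendsto' h2 fun k => hsub k (by simp [h0])
        exact this.trans zero_le
      · have htop : ediam t ≠ ∞ := (ht.trans_lt ENNReal.coe_lt_top).ne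
        have hd0 : 0 < (ediam t).toReal := ENNReal.toReal_pos h0 htop
        have hd1 : (ediam t).toReal ≤ 1 := by
          have := ENNReal.toReal_mono (by simp) ht
          simpa using this
        obtain ⟨k, hk1, hk2⟩ := exists_nat_pow_near_of_lt_one hd0 hd1
          (y := (1 : ℝ) / 2) (by norm_num) (by norm_num)
        have hk2' : ediam t ≤ ENNReal.ofReal ((1 / 2) ^ k) := by
          rw [← ENNReal.ofReal_toReal htop]; exact ENNReal.ofReal_le_ofReal hk2
        have hk1' : ENNReal.ofReal ((1 / 2) ^ k) ≤ 2 * ediam t := by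
          rw [← ENNReal.ofReal_toReal htop]
          rw [show (2 : ℝ≥0∞) = ENNReal.ofReal 2 by simp, ← ENNReal.ofReal_mul (by norm_num)]
          refine ENNReal.ofReal_le_ofReal ?_
          rw [pow_succ] at hk1
          linarith
        calc ν (t ∩ E j) ≤ (j + 1) * ENNReal.ofReal ((1 / 2) ^ k) ^ (s : ℝ) := hsub k hk2'
          _ ≤ (j + 1) * (2 * ediam t) ^ (s : ℝ) := by gcongr
          _ = ediam t ^ (s : ℝ) * c := by
            rw [ENNReal.mul_rpow_of_nonneg _ _ hs'.le, hc]; ring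
    intro A hA
    have := hmain A
    rw [hA, Measure.smul_apply, smul_eq_mul] at this
    have h3 := le_antisymm this zero_le
    rcases mul_eq_zero.1 h3 with h4 | h4
    · exact absurd h4 (ENNReal.inv_ne_zero.2 hct)
    · exact h4
  have hac : ν ≪ (Measure.hausdorffMeasure (s : ℝ) : Measure ℝ) := by
    intro A hA
    have h1 : ∀ᵐ x ∂ν, x ∈ ⋃ j, E j := by
      filter_upwards [h] with x ⟨C, hC⟩
      obtain ⟨j, hj⟩ := exists_nat_ge C
      refine mem_iUnion.2 ⟨j, fun k => (hC k).trans ?_⟩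
      gcongr
      exact_mod_cast hj
    have h2 : ν (⋃ j, A ∩ E j) = 0 := measure_iUnion_null fun j => by
      have := hle j hA
      rwa [Measure.restrict_apply' (hE j)] at this
    rw [← inter_iUnion] at h2
    refine le_antisymm ?_ zero_le
    calc ν A ≤ ν (A ∩ ⋃ j, E j) + ν (⋃ j, E j)ᶜ :=
          (measure_mono (fun x hx => by
            by_cases h : x ∈ ⋃ j, E j
            exacts [Or.inl ⟨hx, h⟩, Or.inr h])).trans (measure_union_le _ _)
      _ = 0 := by rw [h2, zero_add]; exact h1
  refine le_iInf₂ fun S hS => ?_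
  by_contra hlt
  have h0 := measure_zero_of_dimH_lt hac (not_le.1 hlt)
  have : ν univ ≤ 0 := by
    rw [← union_compl_self S]
    exact (measure_union_le _ _).trans (by rw [h0, hS, zero_add])
  simp at this

end Densities

/-! ### Sums of partial products -/

section PerpetuitySeries
open Set Filter Topology

/-- The product of the first `n` factors. -/
noncomputable def partialProd (z : ℕ → ℝ) (n : ℕ) : ℝ := ∏ i ∈ Finset.range n, z i

/-- The sum of the partial products, with values in `[0, ∞]`. -/
noncomputable def perpetuityENN (z : ℕ → ℝ) : ℝ≥0∞ := ∑' n, ENNReal.ofReal (partialProd z n)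

/-- The sum of the partial products. -/
noncomputable def perpetuity (z : ℕ → ℝ) : ℝ := (perpetuityENN z).toReal

lemma partialProd_pos {z : ℕ → ℝ} (hz : ∀ i, 0 < z i) (n : ℕ) : 0 < partialProd z n :=
  Finset.prod_pos fun i _ => hz i

lemma partialProd_add (z : ℕ → ℝ) (n k : ℕ) :
    partialProd z (n + k) = partialProd z n * partialProd (fun i => z (i + n)) k := by
  simp only [partialProd, Finset.prod_range_add]
  congr 1
  exact Finset.prod_congr rfl fun i _ => by rw [add_comm]

lemma partialProd_succ (z : ℕ → ℝ) (n : ℕ) :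
    partialProd z (n + 1) = partialProd z n * z n := by
  simp only [partialProd, Finset.prod_range_succ]

lemma partialProd_congr {z z' : ℕ → ℝ} {n : ℕ} (h : ∀ i < n, z i = z' i) :
    partialProd z n = partialProd z' n :=
  Finset.prod_congr rfl fun i hi => h i (Finset.mem_range.1 hi)

@[fun_prop]
lemma measurable_partialProd (n : ℕ) : Measurable fun z : ℕ → ℝ => partialProd z n := by
  unfold partialProd; fun_prop

@[fun_prop]
lemma measurable_perpetuityENN : Measurable perpetuityENN := by
  unfold perpetuityENN
  exact Measurable.tsum fun n => (measurable_partialProd n).ennreal_ofReal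

@[fun_prop]
lemma measurable_perpetuity : Measurable perpetuity :=
  measurable_perpetuityENN.ennreal_toReal

lemma perpetuity_nonneg (z : ℕ → ℝ) : 0 ≤ perpetuity z := ENNReal.toReal_nonneg

/-- Convergence is not needed: both sides are 0 when the series diverges. -/
lemma perpetuity_eq_tsum {z : ℕ → ℝ} (hz : ∀ i, 0 < z i) :
    perpetuity z = ∑' n, partialProd z n := by
  rw [perpetuity, perpetuityENN, ENNReal.tsum_toReal_eq fun _ => ENNReal.ofReal_ne_top]
  exact tsum_congr fun n => ENNReal.toReal_ofReal (partialProd_pos hz n).le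

lemma perpetuityENN_ne_top_iff {z : ℕ → ℝ} (hz : ∀ i, 0 < z i) :
    perpetuityENN z ≠ ∞ ↔ Summable (partialProd z) := by
  constructor
  · intro h
    refine (ENNReal.summable_toReal h).congr fun n => ?_
    exact ENNReal.toReal_ofReal (partialProd_pos hz n).le
  · intro h
    exact h.tsum_ofReal_ne_top

lemma perpetuityENN_eq_add {z : ℕ → ℝ} (hz : ∀ i, 0 < z i) (n : ℕ) :
    perpetuityENN z = ENNReal.ofReal (∑ i ∈ Finset.range n, partialProd z i) +
      ENNReal.ofReal (partialProd z n) * perpetuityENN (fun i => z (i + n)) := by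
  rw [ENNReal.ofReal_sum_of_nonneg fun i _ => (partialProd_pos hz i).le]
  refine (Summable.sum_add_tsum_nat_add' (k := n) ENNReal.summable).symm.trans ?_
  congr 1
  rw [perpetuityENN, ← ENNReal.tsum_mul_left]
  refine tsum_congr fun k => ?_
  rw [add_comm, partialProd_add, ENNReal.ofReal_mul (partialProd_pos hz n).le]

lemma perpetuity_eq_add {z : ℕ → ℝ} (hz : ∀ i, 0 < z i) (h : perpetuityENN z ≠ ∞) (n : ℕ) :
    perpetuity z = ∑ i ∈ Finset.range n, partialProd z i +
      partialProd z n * perpetuity (fun i => z (i + n)) := by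
  have h' := h
  rw [perpetuityENN_eq_add hz n, ENNReal.add_ne_top] at h'
  rw [perpetuity, perpetuityENN_eq_add hz n, ENNReal.toReal_add h'.1 h'.2, ENNReal.toReal_mul,
    ENNReal.toReal_ofReal (partialProd_pos hz n).le,
    ENNReal.toReal_ofReal (Finset.sum_nonneg fun i _ => (partialProd_pos hz i).le)]
  rfl

/-- The value of a coin toss as a factor. -/
noncomputable def coinValue (a : ℝ) (b : Bool) : ℝ := if b then 1 + a else 1 - a

/-- The sequence of factors given by coin tosses and errors. -/
noncomputable def factorSeq (a : ℝ) (u : ℕ → Bool) (y : ℕ → ℝ) (i : ℕ) : ℝ :=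
  coinValue a (u i) * y i

lemma coinValue_pos {a : ℝ} (ha₀ : 0 < a) (ha₁ : a < 1) (b : Bool) : 0 < coinValue a b := by
  cases b <;> simp [coinValue] <;> linarith

lemma factorSeq_pos {a : ℝ} (ha₀ : 0 < a) (ha₁ : a < 1) (u : ℕ → Bool) {y : ℕ → ℝ}
    (hy : ∀ i, 0 < y i) (i : ℕ) : 0 < factorSeq a u y i :=
  mul_pos (coinValue_pos ha₀ ha₁ _) (hy i)

lemma abs_coinValue_sub {a : ℝ} (ha₀ : 0 < a) {b b' : Bool} (h : b ≠ b') :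
    |coinValue a b - coinValue a b'| = 2 * a := by
  cases b <;> cases b' <;> simp [coinValue] at h ⊢
  · rw [show 1 - a - (1 + a) = -(2 * a) by ring, abs_neg, abs_of_pos (by linarith)]
  · rw [show a + a = 2 * a by ring, abs_of_pos (by linarith)]

@[fun_prop]
lemma measurable_coinValue (a : ℝ) : Measurable (coinValue a) := measurable_of_countable _

@[fun_prop]
lemma measurable_factorSeq (a : ℝ) :
    Measurable fun x : (ℕ → Bool) × (ℕ → ℝ) => factorSeq a x.1 x.2 := by
  unfold factorSeq
  fun_prop

lemma fairChoice_eq_map (a : ℝ) : fairChoice a = coin.map (coinValue a) := by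
  rw [coin, Measure.map_add _ _ (measurable_coinValue a), Measure.map_smul, Measure.map_smul,
    Measure.map_dirac' (measurable_coinValue a), Measure.map_dirac' (measurable_coinValue a)]
  simp [fairChoice, coinValue]

/-- Two series which separate at time `n`: the dependence of the difference on the error with
index `n + 1` is affine. -/
lemma perpetuity_sub_eq {z z' : ℕ → ℝ} (hz : ∀ i, 0 < z i) (hz' : ∀ i, 0 < z' i)
    (h : perpetuityENN z ≠ ∞) (h' : perpetuityENN z' ≠ ∞) (n : ℕ) (heq : ∀ i < n, z i = z' i) :
    perpetuity z - perpetuity z' = partialProd z n * ((z n - z' n) +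
      (z n * z (n + 1) * perpetuity (fun i => z (i + (n + 2))) -
        z' n * z' (n + 1) * perpetuity (fun i => z' (i + (n + 2))))) := by
  -- Expanding to `n + 2` exposes the separating factor `n` and the factor `n + 1`, while the
  -- remaining tails involve neither.
  rw [perpetuity_eq_add hz h (n + 2), perpetuity_eq_add hz' h' (n + 2)]
  have e : ∀ i ≤ n, partialProd z i = partialProd z' i := fun i hi =>
    partialProd_congr fun j hj => heq j (by omega)
  rw [Finset.sum_range_succ, Finset.sum_range_succ _ (n + 1), partialProd_succ z (n + 1),
    partialProd_succ z' (n + 1), partialProd_succ z n, partialProd_succ z' n, e n le_rfl,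
    Finset.sum_congr rfl fun i hi => e i (Nat.lt_succ_iff.1 (Finset.mem_range.1 hi))]
  ring

end PerpetuitySeries

/-! ### Transversality for two toss sequences -/

section PairEstimate
open Set Filter Topology

lemma IsErrorLaw.le_mul_volume {η : Measure ℝ} {ε₁ ε₂ : ℝ} (hη : IsErrorLaw η ε₁ ε₂) :
    ∃ C : ℝ≥0, ∀ s, η s ≤ C * volume s := by
  have := hη.isProbabilityMeasure
  obtain ⟨C, hC⟩ := hη.bounded_density
  have hle : η ≤ (C : ℝ≥0∞) • (volume : Measure ℝ) := by
    refine Measure.le_iff.2 fun s hs => ?_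
    rw [← Measure.withDensity_rnDeriv_eq η volume hη.absolutelyContinuous,
      withDensity_apply _ hs]
    calc ∫⁻ x in s, η.rnDeriv volume x ≤ ∫⁻ _ in s, (C : ℝ≥0∞) :=
          lintegral_mono_ae (ae_restrict_of_ae hC)
      _ = _ := by simp
  exact ⟨C, fun s => hle s⟩

/-- If `r ≤ a` and some admissible `t` exists, then `B * |V| ≥ |d| - r ≥ a`, so the admissible `t`
lie in an interval of length at most `2 * B * r / a`. If `r ≥ a`, the summand 1 in the constant
makes the bound at least 1. -/
lemma measure_affine_small_le {η : Measure ℝ} [IsProbabilityMeasure η] {C : ℝ≥0}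
    (hC : ∀ s, η s ≤ C * volume s) {a b B d V r : ℝ} (ha : 0 < a) (hb : 0 ≤ b) (hB : 0 < B)
    (hr : 0 ≤ r) (hd : |d| = 2 * a) :
    η {t | t ∈ Ioo b B ∧ |d + t * V| ≤ r} ≤ ENNReal.ofReal ((2 * C * B + 1) / a * r) := by
  have hC0 : (0 : ℝ) ≤ C := C.2
  rcases le_total r a with hra | hra
  · rcases eq_empty_or_nonempty {t | t ∈ Ioo b B ∧ |d + t * V| ≤ r} with h0 | ⟨t₀, ht₀, ht₀'⟩
    · rw [h0, measure_empty]; exact zero_le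
    have hV : a ≤ B * |V| := by
      have h1 : |d| ≤ |d + t₀ * V| + |t₀ * V| := by
        have := abs_sub (d + t₀ * V) (t₀ * V)
        simpa using this
      have h2 : |t₀ * V| ≤ B * |V| := by
        rw [abs_mul, abs_of_nonneg (hb.trans ht₀.1.le)]
        exact mul_le_mul_of_nonneg_right ht₀.2.le (abs_nonneg _)
      linarith
    have hV0 : 0 < |V| := by
      by_contra h
      have : |V| = 0 := le_antisymm (not_lt.1 h) (abs_nonneg _)
      rw [this] at hV; linarith
    have hsub : {t | t ∈ Ioo b B ∧ |d + t * V| ≤ r} ⊆ Metric.closedBall (-d / V) (r / |V|) := by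
      rintro t ⟨_, ht⟩
      rw [Metric.mem_closedBall, Real.dist_eq, le_div_iff₀ hV0, ← abs_mul]
      have hV1 : V ≠ 0 := abs_pos.1 hV0
      have : (t - -d / V) * V = d + t * V := by field_simp; ring
      rwa [this]
    calc η _ ≤ η (Metric.closedBall (-d / V) (r / |V|)) := measure_mono hsub
      _ ≤ C * ENNReal.ofReal (2 * (r / |V|)) := by
        rw [← Real.volume_closedBall]; exact hC _
      _ = ENNReal.ofReal (C * (2 * (r / |V|))) := by
        rw [ENNReal.ofReal_mul hC0, ENNReal.ofReal_coe_nnreal]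
      _ ≤ _ := by
        refine ENNReal.ofReal_le_ofReal ?_
        have h3 : r / |V| ≤ B * r / a := by
          rw [div_le_div_iff₀ hV0 ha]
          nlinarith
        calc C * (2 * (r / |V|)) ≤ C * (2 * (B * r / a)) := by gcongr
          _ = (2 * C * B) / a * r := by ring
          _ ≤ _ := by gcongr; linarith
  · calc η _ ≤ 1 := prob_le_one
      _ ≤ _ := by
        rw [ENNReal.one_le_ofReal]
        calc (1 : ℝ) ≤ r / a := (one_le_div ha).2 hra
          _ = 1 / a * r := by ring
          _ ≤ _ := by
            gcongr
            nlinarith [mul_nonneg hC0 hB.le]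

/-- The error sequences in a box for which both series converge, the first `n` factors of one of
them are not too small, and the sums are close. -/
def closePairs (a b B : ℝ) (u v : ℕ → Bool) (n : ℕ) (c ρ : ℝ) : Set (ℕ → ℝ) :=
  {y | (∀ i, y i ∈ Ioo b B) ∧ perpetuityENN (factorSeq a u y) ≠ ∞ ∧
    perpetuityENN (factorSeq a v y) ≠ ∞ ∧ c ≤ partialProd (factorSeq a u y) n ∧
    |perpetuity (factorSeq a u y) - perpetuity (factorSeq a v y)| ≤ ρ}

@[fun_prop]
lemma measurable_factorSeq_right (a : ℝ) (u : ℕ → Bool) : Measurable (factorSeq a u) := by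
  unfold factorSeq
  fun_prop

lemma measurableSet_closePairs (a b B : ℝ) (u v : ℕ → Bool) (n : ℕ) (c ρ : ℝ) :
    MeasurableSet (closePairs a b B u v n c ρ) := by
  have h1 : Measurable fun y => perpetuityENN (factorSeq a u y) := by fun_prop
  have h2 : Measurable fun y => perpetuityENN (factorSeq a v y) := by fun_prop
  have e : closePairs a b B u v n c ρ = (⋂ i : ℕ, {y | y i ∈ Ioo b B}) ∩
    ({y | perpetuityENN (factorSeq a u y) ≠ ∞} ∩ ({y | perpetuityENN (factorSeq a v y) ≠ ∞} ∩
    ({y | c ≤ partialProd (factorSeq a u y) n} ∩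
    {y | |perpetuity (factorSeq a u y) - perpetuity (factorSeq a v y)| ≤ ρ}))) := by
    ext y; simp [closePairs]
  rw [e]
  refine MeasurableSet.inter (.iInter fun i => ?_) (MeasurableSet.inter ?_ (.inter ?_ (.inter ?_ ?_)))
  · exact measurableSet_Ioo.preimage (measurable_pi_apply i)
  · exact (h1 (measurableSet_singleton ∞)).compl
  · exact (h2 (measurableSet_singleton ∞)).compl
  · exact measurableSet_le measurable_const (by fun_prop)
  · exact measurableSet_le (Measurable.abs (by fun_prop)) measurable_const

/-- Freeze all errors except the one with index `n + 1` and resample that one. The error with index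
`n` would not serve, being a common factor of the whole difference. This common factor together with
the partial product is at least `c * b`, which leaves an affine function of the resampled error. -/
lemma measure_closePairs_le {η : Measure ℝ} [IsProbabilityMeasure η] {C : ℝ≥0}
    (hC : ∀ s, η s ≤ C * volume s) {a b B c ρ : ℝ} (ha₀ : 0 < a) (ha₁ : a < 1) (hb : 0 < b)
    (hB : 0 < B) (hc : 0 < c) (hρ : 0 ≤ ρ) {u v : ℕ → Bool} {n : ℕ} (heq : ∀ i < n, u i = v i)
    (hne : u n ≠ v n) :
    Measure.infinitePi (fun _ : ℕ => η) (closePairs a b B u v n c ρ) ≤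
      ENNReal.ofReal ((2 * C * B + 1) / a * (ρ / (c * b))) := by
  have hm := measurableSet_closePairs a b B u v n c ρ
  have hup : Measurable fun x : (ℕ → ℝ) × ℝ => Function.update x.1 (n + 1) x.2 := by
    refine measurable_pi_iff.2 fun i => ?_
    by_cases hi : i = n + 1
    · subst hi; simpa using measurable_snd
    · simp only [Function.update_of_ne hi]; fun_prop
  rw [← map_update_infinitePi η (n + 1), Measure.map_apply hup hm, Measure.prod_apply (hup hm)]
  calc _ ≤ ∫⁻ _, ENNReal.ofReal ((2 * C * B + 1) / a * (ρ / (c * b)))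
        ∂(Measure.infinitePi fun _ : ℕ => η) := ?_
    _ = _ := by simp
  refine lintegral_mono fun y => ?_
  set T : (ℕ → Bool) → ℝ := fun w => perpetuity fun i => coinValue a (w (i + (n + 2))) *
    y (i + (n + 2))
  refine (measure_mono ?_).trans (measure_affine_small_le hC (d := coinValue a (u n) -
    coinValue a (v n)) (V := coinValue a (u n) * coinValue a (u (n + 1)) * T u -
      coinValue a (v n) * coinValue a (v (n + 1)) * T v) ha₀ hb.le hB
      (div_nonneg hρ (mul_pos hc hb).le) (abs_coinValue_sub ha₀ hne))
  rintro t ⟨hbox, hu, hv, hcp, hd⟩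
  set y' := Function.update y (n + 1) t with hy'
  have hpos : ∀ i, 0 < y' i := fun i => hb.trans (hbox i).1
  have ht : y' (n + 1) = t := by simp [hy']
  refine ⟨ht ▸ hbox (n + 1), ?_⟩
  rw [perpetuity_sub_eq (factorSeq_pos ha₀ ha₁ u hpos) (factorSeq_pos ha₀ ha₁ v hpos) hu hv n
    (fun i hi => by simp only [factorSeq, heq i hi])] at hd
  -- The tails start after the resampled coordinate, so the slope does not depend on `t`.
  have hT : ∀ w : ℕ → Bool, perpetuity (fun i => factorSeq a w y' (i + (n + 2))) = T w := by
    intro w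
    refine congrArg perpetuity (funext fun i => ?_)
    simp only [factorSeq, hy']
    rw [Function.update_of_ne (by omega)]
  rw [hT, hT] at hd
  simp only [factorSeq, ht] at hd
  rw [show coinValue a (u n) * y' n - coinValue a (v n) * y' n +
      (coinValue a (u n) * y' n * (coinValue a (u (n + 1)) * t) * T u -
        coinValue a (v n) * y' n * (coinValue a (v (n + 1)) * t) * T v) =
      y' n * (coinValue a (u n) - coinValue a (v n) + t * (coinValue a (u n) *
        coinValue a (u (n + 1)) * T u - coinValue a (v n) * coinValue a (v (n + 1)) * T v)) by
      ring, ← mul_assoc, abs_mul] at hd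
  rw [le_div_iff₀ (mul_pos hc hb), mul_comm]
  refine le_trans ?_ hd
  gcongr
  have h1 : 0 < y' n := hpos n
  have h2 := (hbox n).1
  change c ≤ partialProd (factorSeq a u y') n at hcp
  rw [abs_of_pos (mul_pos (hc.trans_le hcp) h1)]
  exact mul_le_mul hcp h2.le hb.le (hc.le.trans hcp)

end PairEstimate

/-! ### Mean mass of small balls -/

section Energy
open Set Filter Topology

/-- The law of an infinite sequence of fair coin tosses. -/
noncomputable def tossLaw : Measure (ℕ → Bool) := Measure.infinitePi fun _ : ℕ => coin

/-- The law of an i.i.d. sequence of errors. -/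
noncomputable def errorLaw (η : Measure ℝ) : Measure (ℕ → ℝ) := Measure.infinitePi fun _ : ℕ => η

instance : IsProbabilityMeasure tossLaw := by unfold tossLaw; infer_instance

instance (η : Measure ℝ) [IsProbabilityMeasure η] : IsProbabilityMeasure (errorLaw η) := by
  unfold errorLaw; infer_instance

lemma setOf_agree_eq (u : ℕ → Bool) (n : ℕ) :
    {v : ℕ → Bool | ∀ i < n, u i = v i} = Set.pi (Finset.range n) fun i => {u i} := by
  ext v; simp [Set.mem_pi, eq_comm]

lemma measurableSet_agree (u : ℕ → Bool) (n : ℕ) :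
    MeasurableSet {v : ℕ → Bool | ∀ i < n, u i = v i} := by
  rw [setOf_agree_eq]
  exact MeasurableSet.pi (Finset.countable_toSet _) fun i _ => measurableSet_singleton _

lemma tossLaw_agree (u : ℕ → Bool) (n : ℕ) :
    tossLaw {v | ∀ i < n, u i = v i} = 2⁻¹ ^ n := by
  rw [setOf_agree_eq, tossLaw, Measure.infinitePi_pi _ fun i _ => measurableSet_singleton _]
  simp [coin_singleton]

lemma tossLaw_ae_ne (u : ℕ → Bool) : ∀ᵐ v ∂tossLaw, v ≠ u := by
  have h : tossLaw {u} ≤ 0 := by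
    refine ge_of_tendsto' (ENNReal.tendsto_pow_atTop_nhds_zero_of_lt_one
      (r := (2⁻¹ : ℝ≥0∞)) (by simp)) fun n => ?_
    rw [← tossLaw_agree u n]
    exact measure_mono (by rintro v rfl i _; rfl)
  rw [ae_iff]
  simpa using h

lemma errorLaw_ae_of_ae {η : Measure ℝ} [IsProbabilityMeasure η] {p : ℝ → Prop}
    (h : ∀ᵐ x ∂η, p x) : ∀ᵐ y ∂errorLaw η, ∀ i, p (y i) :=
  ae_all_iff.2 fun i =>
    (measurePreserving_eval_infinitePi (fun _ : ℕ => η) i).quasiMeasurePreserving.ae h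

lemma ae_ae_swap_of_ae_prod {α β : Type*} [MeasurableSpace α] [MeasurableSpace β]
    {μ : Measure α} {ν : Measure β} [SFinite μ] [SFinite ν] {p : α × β → Prop}
    (h : ∀ᵐ x ∂μ.prod ν, p x) : ∀ᵐ y ∂ν, ∀ᵐ x ∂μ, p (x, y) := by
  have := (Measure.measurePreserving_swap (μ := ν) (ν := μ)).quasiMeasurePreserving.ae h
  exact Measure.ae_ae_of_ae_prod this

/-- The conditional law of the series given the errors. -/
noncomputable def quenchedLaw (a : ℝ) (y : ℕ → ℝ) : Measure ℝ :=
  tossLaw.map fun u => perpetuity (factorSeq a u y)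

@[fun_prop]
lemma measurable_factorSeq_left (a : ℝ) (y : ℕ → ℝ) : Measurable fun u => factorSeq a u y := by
  unfold factorSeq
  fun_prop

instance (a : ℝ) (y : ℕ → ℝ) : IsProbabilityMeasure (quenchedLaw a y) :=
  Measure.isProbabilityMeasure_map (Measurable.aemeasurable (by fun_prop))

lemma quenchedLaw_closedBall (a : ℝ) (y : ℕ → ℝ) (x ρ : ℝ) :
    quenchedLaw a y (Metric.closedBall x ρ) =
      tossLaw {v | |x - perpetuity (factorSeq a v y)| ≤ ρ} := by
  rw [quenchedLaw, Measure.map_apply (by fun_prop) Metric.isClosed_closedBall.measurableSet]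
  congr 1
  ext v
  simp [Real.dist_eq, abs_sub_comm]

/-- By Fubini the integral is bounded by the probability that two sums with independent tosses and
common errors are `ρ`-close. Agreement up to `n` has probability `2^(-n)`, and separation at `n`
then costs `D * ρ * θ^(-n)`, or its `s`-th power. The resulting geometric series has ratio `1 / (2 *
θ^s) < 1`. -/
lemma lintegral_quenchedLaw_closedBall_le {η : Measure ℝ} [IsProbabilityMeasure η] {C : ℝ≥0}
    (hC : ∀ s, η s ≤ C * volume s) {a b B : ℝ} (ha₀ : 0 < a) (ha₁ : a < 1) (hb : 0 < b)
    (hB : 0 < B) (hη : ∀ᵐ x ∂η, x ∈ Ioo b B)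
    (hconv : ∀ᵐ x ∂tossLaw.prod (errorLaw η), perpetuityENN (factorSeq a x.1 x.2) ≠ ∞)
    {s θ κ : ℝ} (hs₀ : 0 < s) (hs₁ : s ≤ 1) (hθ : 0 < θ) (hθs : 1 < 2 * θ ^ s) (hκ : 0 < κ) :
    ∃ K : ℝ≥0, ∀ ρ : ℝ, 0 ≤ ρ →
      ∫⁻ x in {x | ∀ n, κ * θ ^ n ≤ partialProd (factorSeq a x.1 x.2) n},
        quenchedLaw a x.2 (Metric.closedBall (perpetuity (factorSeq a x.1 x.2)) ρ)
        ∂tossLaw.prod (errorLaw η) ≤ K * ENNReal.ofReal ρ ^ s := by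
  set D : ℝ := (2 * C * B + 1) / a / (κ * b) with hD
  have hD0 : 0 ≤ D := by
    have : (0 : ℝ) ≤ C := C.2
    positivity
  set r : ℝ≥0∞ := 2⁻¹ * ENNReal.ofReal (θ⁻¹) ^ s with hr
  have hr1 : r < 1 := by
    have h2 : r = ENNReal.ofReal (2 * θ ^ s)⁻¹ := by
      rw [hr, ENNReal.ofReal_rpow_of_pos (by positivity), Real.inv_rpow hθ.le, mul_inv,
        ENNReal.ofReal_mul (by norm_num), ENNReal.ofReal_inv_of_pos (show (0 : ℝ) < 2 by norm_num)]
      simp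
    rw [h2, ENNReal.ofReal_lt_one]
    exact inv_lt_one_of_one_lt₀ hθs
  have hKtop : ENNReal.ofReal D ^ s * (1 - r)⁻¹ ≠ ∞ := by
    refine ENNReal.mul_ne_top (ENNReal.rpow_ne_top_of_nonneg hs₀.le ENNReal.ofReal_ne_top) ?_
    rw [ENNReal.inv_ne_top]
    exact (tsub_pos_of_lt hr1).ne'
  refine ⟨(ENNReal.ofReal D ^ s * (1 - r)⁻¹).toNNReal, fun ρ hρ => ?_⟩
  rw [ENNReal.coe_toNNReal hKtop]
  have hfu : Measurable fun w : ((ℕ → Bool) × (ℕ → ℝ)) × (ℕ → Bool) =>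
      factorSeq a w.1.1 w.1.2 := (measurable_factorSeq a).comp measurable_fst
  have hfv : Measurable fun w : ((ℕ → Bool) × (ℕ → ℝ)) × (ℕ → Bool) =>
      factorSeq a w.2 w.1.2 := 
      (measurable_factorSeq a).comp (measurable_snd.prodMk (measurable_snd.comp measurable_fst))
  let W : Set (((ℕ → Bool) × (ℕ → ℝ)) × (ℕ → Bool)) :=
    {w | (∀ n, w.1.2 n ∈ Ioo b B) ∧ perpetuityENN (factorSeq a w.1.1 w.1.2) ≠ ∞ ∧
      perpetuityENN (factorSeq a w.2 w.1.2) ≠ ∞ ∧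
      (∀ n, κ * θ ^ n ≤ partialProd (factorSeq a w.1.1 w.1.2) n) ∧
      |perpetuity (factorSeq a w.1.1 w.1.2) - perpetuity (factorSeq a w.2 w.1.2)| ≤ ρ}
  have hW : MeasurableSet W := by
    have e : W = (⋂ n : ℕ, {w | w.1.2 n ∈ Ioo b B}) ∩
      ({w | perpetuityENN (factorSeq a w.1.1 w.1.2) ≠ ∞} ∩
      ({w | perpetuityENN (factorSeq a w.2 w.1.2) ≠ ∞} ∩
      ((⋂ n : ℕ, {w | κ * θ ^ n ≤ partialProd (factorSeq a w.1.1 w.1.2) n}) ∩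
      {w | |perpetuity (factorSeq a w.1.1 w.1.2) - perpetuity (factorSeq a w.2 w.1.2)| ≤ ρ}))) := by
      ext w; simp [W]
    rw [e]
    refine .inter (.iInter fun n => ?_) (.inter ?_ (.inter ?_ (.inter (.iInter fun n => ?_) ?_)))
    · exact measurableSet_Ioo.preimage (by fun_prop)
    · exact ((measurable_perpetuityENN.comp hfu) (measurableSet_singleton ∞)).compl
    · exact ((measurable_perpetuityENN.comp hfv) (measurableSet_singleton ∞)).compl
    · exact measurableSet_le measurable_const ((measurable_partialProd n).comp hfu)
    · exact measurableSet_le ((measurable_perpetuity.comp hfu).sub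
        (measurable_perpetuity.comp hfv)).abs measurable_const
  have hG : MeasurableSet {x : (ℕ → Bool) × (ℕ → ℝ) |
      ∀ n, κ * θ ^ n ≤ partialProd (factorSeq a x.1 x.2) n} := by
    rw [ofPred_forall]
    exact .iInter fun n => measurableSet_le measurable_const
      ((measurable_partialProd n).comp (measurable_factorSeq a))
  have hbox : ∀ᵐ x ∂tossLaw.prod (errorLaw η), ∀ i, x.2 i ∈ Ioo b B :=
    Measure.quasiMeasurePreserving_snd.ae (errorLaw_ae_of_ae hη)
  have hconv' : ∀ᵐ x ∂tossLaw.prod (errorLaw η),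
      ∀ᵐ v ∂tossLaw, perpetuityENN (factorSeq a v x.2) ≠ ∞ :=
    Measure.quasiMeasurePreserving_snd.ae (ae_ae_swap_of_ae_prod hconv)
  have step1 : ∫⁻ x in {x | ∀ n, κ * θ ^ n ≤ partialProd (factorSeq a x.1 x.2) n},
        quenchedLaw a x.2 (Metric.closedBall (perpetuity (factorSeq a x.1 x.2)) ρ)
        ∂tossLaw.prod (errorLaw η) ≤
      ∫⁻ x, tossLaw (Prod.mk x ⁻¹' W) ∂tossLaw.prod (errorLaw η) := by
    refine (setLIntegral_mono_ae' hG ?_).trans (setLIntegral_le_lintegral _ _)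
    filter_upwards [hbox, hconv, hconv'] with x h1 h2 h3 hx
    rw [quenchedLaw_closedBall]
    refine measure_mono_ae ?_
    filter_upwards [h3] with v h4 h5
    exact ⟨h1, h2, h4, hx, h5⟩
  refine step1.trans ?_
  rw [lintegral_prod _ (measurable_measure_prodMk_left hW).aemeasurable]
  calc _ ≤ ∫⁻ _, ENNReal.ofReal D ^ s * (1 - r)⁻¹ * ENNReal.ofReal ρ ^ s ∂tossLaw :=
        lintegral_mono fun u => ?_
    _ = _ := by simp
  have hWu : MeasurableSet {z : (ℕ → Bool) × (ℕ → ℝ) | ((u, z.2), z.1) ∈ W} :=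
    hW.preimage (f := fun z : (ℕ → Bool) × (ℕ → ℝ) => ((u, z.2), z.1)) (by fun_prop)
  have step2 : ∫⁻ y, tossLaw (Prod.mk (u, y) ⁻¹' W) ∂errorLaw η =
      ∫⁻ v, errorLaw η {y | ((u, y), v) ∈ W} ∂tossLaw :=
    (Measure.prod_apply_symm (μ := tossLaw) (ν := errorLaw η) hWu).symm.trans
      (Measure.prod_apply hWu)
  rw [step2]
  -- Only the term at the first disagreement is needed. Summing over all agreement cylinders
  -- overcounts harmlessly, and their measures are exact powers of 1/2.
  have hterm : ∀ᵐ v ∂tossLaw, errorLaw η {y | ((u, y), v) ∈ W} ≤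
      ∑' n : ℕ, {v : ℕ → Bool | ∀ i < n, u i = v i}.indicator
        (fun _ => ENNReal.ofReal (D * ρ) ^ s * (ENNReal.ofReal θ⁻¹ ^ s) ^ n) v := by
    filter_upwards [tossLaw_ae_ne u] with v hv
    have hex : ∃ n, u n ≠ v n := by
      by_contra h
      push Not at h
      exact hv (funext fun n => (h n).symm)
    classical
    have hn := Nat.find_spec hex
    have hlt : ∀ i < Nat.find hex, u i = v i := fun i hi => not_not.1 (Nat.find_min hex hi)
    set n := Nat.find hex
    refine le_trans ?_ (ENNReal.le_tsum n)
    rw [indicator_of_mem (by exact hlt)]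
    have h1 : errorLaw η {y | ((u, y), v) ∈ W} ≤ ENNReal.ofReal (D * ρ * θ⁻¹ ^ n) := by
      refine (measure_mono ?_).trans ((measure_closePairs_le hC ha₀ ha₁ hb hB
        (mul_pos hκ (pow_pos hθ n)) hρ hlt hn).trans_eq ?_)
      · rintro y ⟨h1, h2, h3, h4, h5⟩
        exact ⟨h1, h2, h3, h4 n, h5⟩
      · congr 1
        rw [hD, inv_pow]
        field_simp
    have h2 : errorLaw η {y | ((u, y), v) ∈ W} ≤ 1 := prob_le_one
    -- A number in `[0, 1]` is at most its `s`-th power, as `s ≤ 1`.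
    calc errorLaw η {y | ((u, y), v) ∈ W} = errorLaw η {y | ((u, y), v) ∈ W} ^ (1 : ℝ) := by simp
      _ ≤ errorLaw η {y | ((u, y), v) ∈ W} ^ s := ENNReal.rpow_le_rpow_of_exponent_ge h2 hs₁
      _ ≤ ENNReal.ofReal (D * ρ * θ⁻¹ ^ n) ^ s := ENNReal.rpow_le_rpow h1 hs₀.le
      _ = _ := by
        rw [ENNReal.ofReal_mul (by positivity), ENNReal.mul_rpow_of_nonneg _ _ hs₀.le,
          ENNReal.ofReal_pow (by positivity), ← ENNReal.rpow_natCast, ← ENNReal.rpow_mul,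
          ← ENNReal.rpow_natCast, ← ENNReal.rpow_mul, mul_comm s]
  calc _ ≤ ∫⁻ v, ∑' n : ℕ, {v : ℕ → Bool | ∀ i < n, u i = v i}.indicator
        (fun _ => ENNReal.ofReal (D * ρ) ^ s * (ENNReal.ofReal θ⁻¹ ^ s) ^ n) v ∂tossLaw :=
        lintegral_mono_ae hterm
    _ = ∑' n : ℕ, ENNReal.ofReal (D * ρ) ^ s * r ^ n := by
      rw [lintegral_tsum fun n =>
        (measurable_const.indicator (measurableSet_agree u n)).aemeasurable]
      refine tsum_congr fun n => ?_
      rw [lintegral_indicator_const (measurableSet_agree u n), tossLaw_agree, hr, mul_pow]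
      ring
    _ = _ := by
      rw [ENNReal.tsum_mul_left, ENNReal.tsum_geometric, ENNReal.ofReal_mul hD0,
        ENNReal.mul_rpow_of_nonneg _ _ hs₀.le]
      ring

end Energy

/-! ### From mean ball masses to almost sure regularity -/

section LocalDimension
open Set Filter Topology

lemma measurable_quenchedLaw_closedBall (a ρ : ℝ) :
    Measurable fun x : (ℕ → Bool) × (ℕ → ℝ) =>
      quenchedLaw a x.2 (Metric.closedBall (perpetuity (factorSeq a x.1 x.2)) ρ) := by
  simp only [quenchedLaw_closedBall]
  have hfu : Measurable fun w : ((ℕ → Bool) × (ℕ → ℝ)) × (ℕ → Bool) =>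
      factorSeq a w.1.1 w.1.2 := (measurable_factorSeq a).comp measurable_fst
  have hfv : Measurable fun w : ((ℕ → Bool) × (ℕ → ℝ)) × (ℕ → Bool) =>
      factorSeq a w.2 w.1.2 :=
    (measurable_factorSeq a).comp (measurable_snd.prodMk (measurable_snd.comp measurable_fst))
  have hm : MeasurableSet {w : ((ℕ → Bool) × (ℕ → ℝ)) × (ℕ → Bool) |
      |perpetuity (factorSeq a w.1.1 w.1.2) - perpetuity (factorSeq a w.2 w.1.2)| ≤ ρ} :=
    measurableSet_le ((measurable_perpetuity.comp hfu).sub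
        (measurable_perpetuity.comp hfv)).abs measurable_const
  exact measurable_measure_prodMk_left hm

lemma ae_quenchedLaw_iff (a : ℝ) (y : ℕ → ℝ) {p : ℝ → Prop} (hp : MeasurableSet {x | p x}) :
    (∀ᵐ x ∂quenchedLaw a y, p x) ↔ ∀ᵐ u ∂tossLaw, p (perpetuity (factorSeq a u y)) :=
  ae_map_iff (Measurable.aemeasurable (by fun_prop)) hp

/-- The constant in the growth bound is random; the mean estimates are applied on each set where it
is fixed. -/
lemma ae_of_ae_restrict_iUnion {α : Type*} [MeasurableSpace α] {μ : Measure α} {G : ℕ → Set α}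
    (hG : ∀ N, MeasurableSet (G N)) (hcov : ∀ᵐ x ∂μ, ∃ N, x ∈ G N) {p : α → Prop}
    (h : ∀ N, ∀ᵐ x ∂μ.restrict (G N), p x) : ∀ᵐ x ∂μ, p x := by
  have h' : ∀ᵐ x ∂μ, ∀ N, x ∈ G N → p x :=
    ae_all_iff.2 fun N => (ae_restrict_iff' (hG N)).1 (h N)
  filter_upwards [hcov, h'] with x ⟨N, hN⟩ hx using hx N hN

lemma measurableSet_partialProd_ge (a κ θ : ℝ) :
    MeasurableSet {x : (ℕ → Bool) × (ℕ → ℝ) |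
      ∀ n, κ * θ ^ n ≤ partialProd (factorSeq a x.1 x.2) n} := by
  rw [ofPred_forall]
  exact .iInter fun n => measurableSet_le measurable_const
    ((measurable_partialProd n).comp (measurable_factorSeq a))

variable {η : Measure ℝ} [IsProbabilityMeasure η] {C : ℝ≥0} {a b B : ℝ}

/-- Since `2 * θ > 1`, the mean estimate holds with exponent 1, and Fatou makes the lower density
finite at almost every value of the sum. -/
lemma ae_quenchedLaw_absolutelyContinuous
    (hC : ∀ s, η s ≤ C * volume s) (ha₀ : 0 < a) (ha₁ : a < 1) (hb : 0 < b)
    (hB : 0 < B) (hη : ∀ᵐ x ∂η, x ∈ Ioo b B)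
    (hconv : ∀ᵐ x ∂tossLaw.prod (errorLaw η), perpetuityENN (factorSeq a x.1 x.2) ≠ ∞)
    {θ : ℝ} (hθ : 1 / 2 < θ)
    (hgrow : ∀ᵐ x ∂tossLaw.prod (errorLaw η), ∃ N : ℕ, ∀ n,
      1 / ((N : ℝ) + 1) * θ ^ n ≤ partialProd (factorSeq a x.1 x.2) n) :
    ∀ᵐ y ∂errorLaw η, quenchedLaw a y ≪ volume := by
  have key : ∀ᵐ x ∂tossLaw.prod (errorLaw η), liminf (fun k : ℕ => 2 ^ k *
      quenchedLaw a x.2 (Metric.closedBall (perpetuity (factorSeq a x.1 x.2)) ((1 / 2) ^ k)))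
      atTop < ∞ := by
    refine ae_of_ae_restrict_iUnion
      (fun N : ℕ => measurableSet_partialProd_ge a (1 / ((N : ℝ) + 1)) θ) hgrow fun N => ?_
    obtain ⟨K, hK⟩ := lintegral_quenchedLaw_closedBall_le hC ha₀ ha₁ hb hB hη hconv one_pos le_rfl
      (show 0 < θ by linarith) (by rw [Real.rpow_one]; linarith)
      (show 0 < 1 / ((N : ℝ) + 1) by positivity)
    have hm : ∀ k : ℕ, Measurable fun x : (ℕ → Bool) × (ℕ → ℝ) => (2 : ℝ≥0∞) ^ k *
        quenchedLaw a x.2 (Metric.closedBall (perpetuity (factorSeq a x.1 x.2)) ((1 / 2) ^ k)) :=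
      fun k => (measurable_quenchedLaw_closedBall a _).const_mul _
    refine ae_lt_top (Measurable.liminf hm) (ne_of_lt ?_)
    refine (lintegral_liminf_le hm).trans_lt (lt_of_le_of_lt (b := (K : ℝ≥0∞)) ?_ (by simp))
    refine liminf_le_of_le (by isBoundedDefault) fun c hc => ?_
    obtain ⟨k, hk⟩ := hc.exists
    refine hk.trans ?_
    rw [lintegral_const_mul _ (measurable_quenchedLaw_closedBall a _)]
    calc _ ≤ 2 ^ k * ((K : ℝ≥0∞) * ENNReal.ofReal ((1 / 2) ^ k) ^ (1 : ℝ)) := by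
          gcongr; exact hK _ (by positivity)
      _ = K * (2 ^ k * ENNReal.ofReal ((1 / 2) ^ k)) := by rw [ENNReal.rpow_one]; ring
      _ = K := by
        rw [show (2 : ℝ≥0∞) = ENNReal.ofReal 2 by simp, ← ENNReal.ofReal_pow (by norm_num),
          ← ENNReal.ofReal_mul (by positivity), ← mul_pow]
        norm_num
  filter_upwards [ae_ae_swap_of_ae_prod key] with y hy
  refine absolutelyContinuous_of_liminf _ ((ae_quenchedLaw_iff a y ?_).2 hy)
  exact measurableSet_lt (Measurable.liminf fun k =>
    (measurable_measure_closedBall _ _).const_mul _) measurable_const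

/-- The gap `s - t` makes the series of ball masses weighted by `2^(k * t)` have finite mean on each
growth set. Its almost surely finite value serves as the constant in the mass distribution
principle. -/
lemma ae_le_measureDimH_quenchedLaw
    (hC : ∀ s, η s ≤ C * volume s) (ha₀ : 0 < a) (ha₁ : a < 1) (hb : 0 < b)
    (hB : 0 < B) (hη : ∀ᵐ x ∂η, x ∈ Ioo b B)
    (hconv : ∀ᵐ x ∂tossLaw.prod (errorLaw η), perpetuityENN (factorSeq a x.1 x.2) ≠ ∞)
    {t : ℝ≥0} {s θ : ℝ} (ht : 0 < t) (hts : t < s) (hs₁ : s ≤ 1) (hθ : 0 < θ)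
    (hθs : 1 < 2 * θ ^ s)
    (hgrow : ∀ᵐ x ∂tossLaw.prod (errorLaw η), ∃ N : ℕ, ∀ n,
      1 / ((N : ℝ) + 1) * θ ^ n ≤ partialProd (factorSeq a x.1 x.2) n) :
    ∀ᵐ y ∂errorLaw η, (t : ℝ≥0∞) ≤ measureDimH (quenchedLaw a y) := by
  have ht' : (0 : ℝ) < t := ht
  set e : ℕ → ℝ≥0∞ := fun k => ENNReal.ofReal ((1 / 2) ^ k) with he
  have he0 : ∀ k, e k ≠ 0 := fun k => (ENNReal.ofReal_pos.2 (by positivity)).ne'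
  have het : ∀ k, e k ≠ ∞ := fun k => ENNReal.ofReal_ne_top
  have key : ∀ᵐ x ∂tossLaw.prod (errorLaw η), ∑' k : ℕ, e k ^ (-(t : ℝ)) *
      quenchedLaw a x.2 (Metric.closedBall (perpetuity (factorSeq a x.1 x.2)) ((1 / 2) ^ k))
      < ∞ := by
    refine ae_of_ae_restrict_iUnion
      (fun N : ℕ => measurableSet_partialProd_ge a (1 / ((N : ℝ) + 1)) θ) hgrow fun N => ?_
    obtain ⟨K, hK⟩ := lintegral_quenchedLaw_closedBall_le hC ha₀ ha₁ hb hB hη hconv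
      (ht'.trans hts) hs₁ hθ hθs (show 0 < 1 / ((N : ℝ) + 1) by positivity)
    have hm : ∀ k : ℕ, Measurable fun x : (ℕ → Bool) × (ℕ → ℝ) => e k ^ (-(t : ℝ)) *
        quenchedLaw a x.2 (Metric.closedBall (perpetuity (factorSeq a x.1 x.2)) ((1 / 2) ^ k)) :=
      fun k => (measurable_quenchedLaw_closedBall a _).const_mul _
    refine ae_lt_top (Measurable.tsum hm) (ne_of_lt ?_)
    rw [lintegral_tsum fun k => (hm k).aemeasurable]
    set r : ℝ≥0∞ := ENNReal.ofReal (1 / 2) ^ (s - t) with hr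
    have hr1 : r < 1 := by
      refine ENNReal.rpow_lt_one ?_ (by linarith)
      rw [ENNReal.ofReal_lt_one]; norm_num
    have hb' : ∀ k, ∫⁻ x in {x | ∀ n, 1 / ((N : ℝ) + 1) * θ ^ n ≤
        partialProd (factorSeq a x.1 x.2) n}, e k ^ (-(t : ℝ)) *
        quenchedLaw a x.2 (Metric.closedBall (perpetuity (factorSeq a x.1 x.2)) ((1 / 2) ^ k))
        ∂tossLaw.prod (errorLaw η) ≤ K * r ^ k := by
      intro k
      rw [lintegral_const_mul _ (measurable_quenchedLaw_closedBall a _)]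
      calc _ ≤ e k ^ (-(t : ℝ)) * ((K : ℝ≥0∞) * e k ^ s) := by
            gcongr; exact hK _ (by positivity)
        _ = K * (e k ^ (-(t : ℝ)) * e k ^ s) := by ring
        _ = K * r ^ k := by
          rw [← ENNReal.rpow_add _ _ (he0 k) (het k), hr, he, neg_add_eq_sub]
          simp only
          rw [ENNReal.ofReal_pow (by norm_num), ← ENNReal.rpow_natCast, ← ENNReal.rpow_natCast,
            ← ENNReal.rpow_mul, ← ENNReal.rpow_mul, mul_comm (k : ℝ)]
    refine (ENNReal.tsum_le_tsum hb').trans_lt ?_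
    rw [ENNReal.tsum_mul_left, ENNReal.tsum_geometric]
    exact ENNReal.mul_lt_top (by simp) (ENNReal.inv_lt_top.2 (tsub_pos_of_lt hr1))
  filter_upwards [ae_ae_swap_of_ae_prod key] with y hy
  refine le_measureDimH _ t ht ?_
  have hy' := (ae_quenchedLaw_iff a y (p := fun x => ∑' k : ℕ, e k ^ (-(t : ℝ)) *
      quenchedLaw a y (Metric.closedBall x ((1 / 2) ^ k)) < ∞) (measurableSet_lt
      (Measurable.tsum fun k => (measurable_measure_closedBall _ _).const_mul _)
      measurable_const)).2 hy
  filter_upwards [hy'] with x hx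
  refine ⟨(∑' k : ℕ, e k ^ (-(t : ℝ)) *
    quenchedLaw a y (Metric.closedBall x ((1 / 2) ^ k))).toNNReal, fun k => ?_⟩
  rw [ENNReal.coe_toNNReal hx.ne]
  have h1 := ENNReal.le_tsum (f := fun k => e k ^ (-(t : ℝ)) *
    quenchedLaw a y (Metric.closedBall x ((1 / 2) ^ k))) k
  calc quenchedLaw a y (Metric.closedBall x ((1 / 2) ^ k)) = e k ^ (-(t : ℝ)) *
        quenchedLaw a y (Metric.closedBall x ((1 / 2) ^ k)) * e k ^ (t : ℝ) := by
        rw [mul_right_comm, ← ENNReal.rpow_add _ _ (he0 k) (het k)]; simp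
    _ ≤ _ := by gcongr

end LocalDimension

/-! ### Exponential rate of the partial products -/

section Growth
open Set Filter Topology

lemma ae_tendsto_average_infinitePi {α : Type*} [MeasurableSpace α] (p : Measure α)
    [IsProbabilityMeasure p] {g : α → ℝ} (hg : Measurable g) (hint : Integrable g p) :
    ∀ᵐ x ∂(Measure.infinitePi fun _ : ℕ => p),
      Tendsto (fun n : ℕ => (∑ i ∈ Finset.range n, g (x i)) / n) atTop (𝓝 (∫ t, g t ∂p)) := by
  have hmap : ∀ i, (Measure.infinitePi fun _ : ℕ => p).map (fun x : ℕ → α => g (x i)) = p.map g :=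
    fun i => by
      rw [show (fun x : ℕ → α => g (x i)) = g ∘ fun x => x i from rfl,
        ← Measure.map_map hg (by fun_prop), Measure.infinitePi_map_eval (fun _ : ℕ => p) i]
  have h := strong_law_ae_real (μ := Measure.infinitePi fun _ : ℕ => p)
    (fun i (x : ℕ → α) => g (x i))
    ((measurePreserving_eval_infinitePi (fun _ : ℕ => p) 0).integrable_comp_of_integrable hint)
    (fun i j hij => (iIndepFun_infinitePi (P := fun _ : ℕ => p) (X := fun _ => g)
      fun _ => hg).indepFun hij)
    (fun i => ⟨(hg.comp (measurable_pi_apply i)).aemeasurable,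
      (hg.comp (measurable_pi_apply 0)).aemeasurable, by rw [hmap, hmap]⟩)
  have hE : (∫ x, g (x 0) ∂(Measure.infinitePi fun _ : ℕ => p)) = ∫ t, g t ∂p := by
    conv_rhs => rw [← Measure.infinitePi_map_eval (fun _ : ℕ => p) 0]
    rw [integral_map (measurable_pi_apply 0).aemeasurable hg.aestronglyMeasurable]
  rwa [hE] at h

lemma integral_log_coinValue {a : ℝ} (ha₀ : 0 < a) (ha₁ : a < 1) :
    ∫ b, Real.log (coinValue a b) ∂coin = Real.log (1 - a ^ 2) / 2 := by
  rw [coin, integral_add_measure (by simp [integrable_smul_measure])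
    (Integrable.smul_measure Integrable.of_finite (by simp)),
    integral_smul_measure, integral_smul_measure, integral_dirac, integral_dirac]
  simp only [coinValue]
  rw [show 1 - a ^ 2 = (1 - a) * (1 + a) by ring, Real.log_mul (by linarith) (by linarith)]
  simp
  ring

lemma integrable_log {η : Measure ℝ} [IsProbabilityMeasure η] {b B : ℝ} (hb : 0 < b)
    (hη : ∀ᵐ x ∂η, x ∈ Ioo b B) : Integrable Real.log η := by
  refine Integrable.of_mem_Icc (Real.log b) (Real.log B) Real.measurable_log.aemeasurable ?_
  filter_upwards [hη] with x hx
  exact ⟨Real.log_le_log hb hx.1.le, Real.log_le_log (hb.trans hx.1) hx.2.le⟩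

lemma log_partialProd {z : ℕ → ℝ} (hz : ∀ i, 0 < z i) (n : ℕ) :
    Real.log (partialProd z n) = ∑ i ∈ Finset.range n, Real.log (z i) :=
  Real.log_prod fun i _ => (hz i).ne'

lemma ae_tendsto_log_partialProd {η : Measure ℝ} [IsProbabilityMeasure η] {a b B : ℝ}
    (ha₀ : 0 < a) (ha₁ : a < 1) (hb : 0 < b) (hη : ∀ᵐ x ∂η, x ∈ Ioo b B)
    (hlog : ∫ x, Real.log x ∂η = 0) :
    ∀ᵐ x ∂tossLaw.prod (errorLaw η), Tendsto
      (fun n : ℕ => Real.log (partialProd (factorSeq a x.1 x.2) n) / n) atTop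
      (𝓝 (Real.log (1 - a ^ 2) / 2)) := by
  have h1 : ∀ᵐ x ∂tossLaw.prod (errorLaw η), _ := Measure.quasiMeasurePreserving_fst.ae
    (ae_tendsto_average_infinitePi coin (g := fun b => Real.log (coinValue a b)) (by fun_prop)
      Integrable.of_finite)
  have h2 : ∀ᵐ x ∂tossLaw.prod (errorLaw η), _ := Measure.quasiMeasurePreserving_snd.ae
    (ae_tendsto_average_infinitePi η Real.measurable_log (integrable_log hb hη))
  have h3 : ∀ᵐ x ∂tossLaw.prod (errorLaw η), _ := Measure.quasiMeasurePreserving_snd.ae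
    (errorLaw_ae_of_ae hη)
  filter_upwards [h1, h2, h3] with x h1 h2 h3
  have hpos := factorSeq_pos ha₀ ha₁ x.1 fun i => hb.trans (h3 i).1
  rw [integral_log_coinValue ha₀ ha₁] at h1
  rw [hlog] at h2
  have h4 := h1.add h2
  rw [add_zero] at h4
  refine h4.congr fun n => ?_
  rw [log_partialProd hpos, ← add_div, ← Finset.sum_add_distrib]
  congr 1
  refine Finset.sum_congr rfl fun i _ => ?_
  rw [factorSeq, Real.log_mul (coinValue_pos ha₀ ha₁ _).ne' (hb.trans (h3 i).1).ne']

lemma exists_forall_le_partialProd {z : ℕ → ℝ} (hz : ∀ i, 0 < z i) {L θ : ℝ}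
    (h : Tendsto (fun n : ℕ => Real.log (partialProd z n) / n) atTop (𝓝 L)) (hθ : 0 < θ)
    (hL : Real.log θ < L) : ∃ N : ℕ, ∀ n, 1 / ((N : ℝ) + 1) * θ ^ n ≤ partialProd z n := by
  have hev : ∀ᶠ n : ℕ in atTop, θ ^ n / partialProd z n ≤ 1 := by
    filter_upwards [h.eventually (lt_mem_nhds hL), eventually_gt_atTop 0] with n hn hn0
    rw [div_le_one (partialProd_pos hz n), ← Real.log_le_log_iff (pow_pos hθ n)
      (partialProd_pos hz n), Real.log_pow]
    have hn0' : (0 : ℝ) < n := by exact_mod_cast hn0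
    rw [lt_div_iff₀ hn0'] at hn
    linarith
  obtain ⟨M, hM⟩ := (isBoundedUnder_of_eventually_le hev).bddAbove_range
  obtain ⟨N, hN⟩ := exists_nat_ge M
  -- Natural-number constants index countably many growth sets; `N + 1` avoids division by zero.
  refine ⟨N, fun n => ?_⟩
  have h1 : θ ^ n / partialProd z n ≤ N + 1 := by
    have := hM (mem_range_self n)
    linarith
  rw [div_le_iff₀ (partialProd_pos hz n)] at h1
  rw [one_div, inv_mul_le_iff₀ (by positivity)]
  exact h1

lemma exists_forall_partialProd_le {z : ℕ → ℝ} (hz : ∀ i, 0 < z i) {L θ : ℝ}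
    (h : Tendsto (fun n : ℕ => Real.log (partialProd z n) / n) atTop (𝓝 L)) (hθ : 0 < θ)
    (hL : L < Real.log θ) : ∃ M : ℝ, ∀ n, partialProd z n ≤ M * θ ^ n := by
  have hev : ∀ᶠ n : ℕ in atTop, partialProd z n / θ ^ n ≤ 1 := by
    filter_upwards [h.eventually (gt_mem_nhds hL), eventually_gt_atTop 0] with n hn hn0
    rw [div_le_one (pow_pos hθ n), ← Real.log_le_log_iff (partialProd_pos hz n) (pow_pos hθ n),
      Real.log_pow]
    have hn0' : (0 : ℝ) < n := by exact_mod_cast hn0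
    rw [div_lt_iff₀ hn0'] at hn
    linarith
  obtain ⟨M, hM⟩ := (isBoundedUnder_of_eventually_le hev).bddAbove_range
  refine ⟨M, fun n => ?_⟩
  rw [← div_le_iff₀ (pow_pos hθ n)]
  exact hM (mem_range_self n)

lemma summable_partialProd_of_le {z : ℕ → ℝ} (hz : ∀ i, 0 < z i) {M θ : ℝ} (hθ : 0 < θ)
    (hθ₁ : θ < 1) (h : ∀ n, partialProd z n ≤ M * θ ^ n) : Summable (partialProd z) :=
  Summable.of_nonneg_of_le (fun n => (partialProd_pos hz n).le) h
    ((summable_geometric_of_lt_one hθ.le hθ₁).mul_left M)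

lemma perpetuity_sub_sum_mem {z : ℕ → ℝ} (hz : ∀ i, 0 < z i) {M θ : ℝ} (hθ : 0 < θ)
    (hθ₁ : θ < 1) (h : ∀ n, partialProd z n ≤ M * θ ^ n) (n : ℕ) :
    perpetuity z - ∑ i ∈ Finset.range n, partialProd z i ∈ Icc 0 (M / (1 - θ) * θ ^ n) := by
  have hs := summable_partialProd_of_le hz hθ hθ₁ h
  rw [perpetuity_eq_tsum hz, ← hs.sum_add_tsum_nat_add n, add_sub_cancel_left]
  refine ⟨tsum_nonneg fun i => (partialProd_pos hz _).le, ?_⟩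
  have hg : HasSum (fun i => M * θ ^ (i + n)) (M / (1 - θ) * θ ^ n) := by
    have := ((hasSum_geometric_of_lt_one hθ.le hθ₁).mul_left M).mul_right (θ ^ n)
    convert! this using 2
    ring
  rw [← hg.tsum_eq]
  exact ((summable_nat_add_iff n).2 hs).tsum_le_tsum (fun i => h _) hg.summable

lemma ae_perpetuityENN_ne_top {η : Measure ℝ} [IsProbabilityMeasure η] {a b B : ℝ}
    (ha₀ : 0 < a) (ha₁ : a < 1) (hb : 0 < b) (hη : ∀ᵐ x ∂η, x ∈ Ioo b B)
    (hlog : ∫ x, Real.log x ∂η = 0) :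
    ∀ᵐ x ∂tossLaw.prod (errorLaw η), perpetuityENN (factorSeq a x.1 x.2) ≠ ∞ := by
  have h3 : ∀ᵐ x ∂tossLaw.prod (errorLaw η), _ := Measure.quasiMeasurePreserving_snd.ae
    (errorLaw_ae_of_ae hη)
  have hL : Real.log (1 - a ^ 2) / 2 < 0 := by
    have : Real.log (1 - a ^ 2) < 0 := Real.log_neg (by nlinarith) (by nlinarith)
    linarith
  filter_upwards [ae_tendsto_log_partialProd ha₀ ha₁ hb hη hlog, h3] with x h h3
  have hpos := factorSeq_pos ha₀ ha₁ x.1 fun i => hb.trans (h3 i).1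
  -- Half of the negative rate lies strictly between the rate and 0.
  obtain ⟨M, hM⟩ := exists_forall_partialProd_le hpos h
    (θ := Real.exp (Real.log (1 - a ^ 2) / 2 / 2)) (Real.exp_pos _)
    (by rw [Real.log_exp]; linarith)
  rw [perpetuityENN_ne_top_iff hpos]
  exact summable_partialProd_of_le hpos (Real.exp_pos _) 
    ((Real.exp_lt_exp.2 (show Real.log (1 - a ^ 2) / 2 / 2 < 0 by linarith)).trans_eq Real.exp_zero)
    hM

end Growth

/-! ### Covering by word intervals -/

section UpperDimension
open Set Filter Topology

/-- A finite word, continued by a constant sequence. -/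
def extendWord {n : ℕ} (w : Fin n → Bool) (i : ℕ) : Bool := if h : i < n then w ⟨i, h⟩ else false

/-- The points within distance `M * θ ^ n` above a partial sum of length `n`, for each `n`. -/
def approximable (a : ℝ) (y : ℕ → ℝ) (M θ : ℝ) : Set ℝ :=
  ⋂ n : ℕ, ⋃ w : Fin n → Bool,
    Icc (∑ i ∈ Finset.range n, partialProd (factorSeq a (extendWord w) y) i)
      (∑ i ∈ Finset.range n, partialProd (factorSeq a (extendWord w) y) i + M * θ ^ n)

lemma measurableSet_approximable (a : ℝ) (y : ℕ → ℝ) (M θ : ℝ) :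
    MeasurableSet (approximable a y M θ) :=
  .iInter fun _ => .iUnion fun _ => measurableSet_Icc

/-- The `2^n` intervals of length `M * θ^n` have `D`-dimensional sum `M^D * (2 * θ^D)^n ≤ M^D`, so
the Hausdorff measure is finite. -/
lemma dimH_approximable_le (a : ℝ) (y : ℕ → ℝ) {M θ : ℝ} (hM : 0 ≤ M) (hθ : 0 < θ) (hθ₁ : θ < 1)
    {D : ℝ≥0} (hD : 2 * θ ^ (D : ℝ) ≤ 1) : dimH (approximable a y M θ) ≤ D := by
  refine dimH_le_of_hausdorffMeasure_ne_top (ne_of_lt ?_)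
  have hr : Tendsto (fun n : ℕ => ENNReal.ofReal (M * θ ^ n)) atTop (𝓝 0) := by
    have := (tendsto_pow_atTop_nhds_zero_of_lt_one hθ.le hθ₁).const_mul M
    rw [mul_zero] at this
    simpa using ENNReal.tendsto_ofReal this
  have h := Measure.hausdorffMeasure_le_liminf_sum (D : ℝ) (approximable a y M θ)
    (ι := fun n : ℕ => Fin n → Bool) _ hr
    (fun n w => Icc (∑ i ∈ Finset.range n, partialProd (factorSeq a (extendWord w) y) i)
      (∑ i ∈ Finset.range n, partialProd (factorSeq a (extendWord w) y) i + M * θ ^ n))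
    (Eventually.of_forall fun n w => by rw [Real.ediam_Icc, add_sub_cancel_left])
    (Eventually.of_forall fun n => iInter_subset _ n)
  refine h.trans_lt (lt_of_le_of_lt (b := ENNReal.ofReal (M ^ (D : ℝ))) ?_ (by simp))
  refine liminf_le_of_le (by isBoundedDefault) fun c hc => ?_
  obtain ⟨n, hn⟩ := hc.exists
  refine hn.trans ?_
  simp only [Real.ediam_Icc, add_sub_cancel_left, Finset.sum_const, Finset.card_univ,
    Fintype.card_pi, Fintype.card_bool, Finset.prod_const, Fintype.card_fin, nsmul_eq_mul]
  rw [ENNReal.ofReal_rpow_of_nonneg (by positivity) D.coe_nonneg]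
  rw [show (((2 ^ n : ℕ) : ℝ≥0∞)) = ENNReal.ofReal (2 ^ n) by
    rw [ENNReal.ofReal_pow (by norm_num)]; simp, ← ENNReal.ofReal_mul (by positivity)]
  refine ENNReal.ofReal_le_ofReal ?_
  rw [Real.mul_rpow hM (by positivity), ← Real.rpow_natCast θ n, ← Real.rpow_mul hθ.le,
    mul_comm (n : ℝ), Real.rpow_mul hθ.le, Real.rpow_natCast]
  calc (2 : ℝ) ^ n * (M ^ (D : ℝ) * (θ ^ (D : ℝ)) ^ n)
      = M ^ (D : ℝ) * (2 * θ ^ (D : ℝ)) ^ n := by rw [mul_pow]; ring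
    _ ≤ M ^ (D : ℝ) * 1 := by gcongr; exact pow_le_one₀ (by positivity) hD
    _ = _ := mul_one _

lemma perpetuity_mem_approximable {a : ℝ} {u : ℕ → Bool} {y : ℕ → ℝ}
    (hz : ∀ i, 0 < factorSeq a u y i) {M θ : ℝ} (hθ : 0 < θ) (hθ₁ : θ < 1)
    (h : ∀ n, partialProd (factorSeq a u y) n ≤ M * θ ^ n) :
    perpetuity (factorSeq a u y) ∈ approximable a y (M / (1 - θ)) θ := by
  refine mem_iInter.2 fun n => mem_iUnion.2 ⟨fun i => u i, ?_⟩
  have e : ∑ i ∈ Finset.range n, partialProd (factorSeq a (extendWord fun i : Fin n => u i) y) i =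
      ∑ i ∈ Finset.range n, partialProd (factorSeq a u y) i := by
    refine Finset.sum_congr rfl fun i hi => partialProd_congr fun j hj => ?_
    have : j < n := hj.trans (Finset.mem_range.1 hi)
    simp [factorSeq, extendWord, this]
  rw [e]
  have := perpetuity_sub_sum_mem hz hθ hθ₁ h n
  exact ⟨by linarith [this.1], by linarith [this.2]⟩

/-- The constant `M` depends on the tosses, but a countable union over natural `M` does not raise
the dimension. -/
lemma ae_measureDimH_quenchedLaw_le {η : Measure ℝ} [IsProbabilityMeasure η] {a b B : ℝ}
    (ha₀ : 0 < a) (ha₁ : a < 1) (hb : 0 < b) (hη : ∀ᵐ x ∂η, x ∈ Ioo b B)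
    (hlog : ∫ x, Real.log x ∂η = 0) {θ : ℝ} (hθ : 0 < θ) (hθ₁ : θ < 1)
    (hL : Real.log (1 - a ^ 2) / 2 < Real.log θ) {D : ℝ≥0} (hD : 2 * θ ^ (D : ℝ) ≤ 1) :
    ∀ᵐ y ∂errorLaw η, measureDimH (quenchedLaw a y) ≤ D := by
  filter_upwards [ae_ae_swap_of_ae_prod (ae_tendsto_log_partialProd ha₀ ha₁ hb hη hlog),
    errorLaw_ae_of_ae hη] with y hy hy'
  have hm : MeasurableSet (⋃ M : ℕ, approximable a y M θ) :=
    .iUnion fun M => measurableSet_approximable _ _ _ _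
  refine (iInf₂_le (⋃ M : ℕ, approximable a y M θ) ?_).trans ?_
  · change ∀ᵐ x ∂quenchedLaw a y, x ∈ ⋃ M : ℕ, approximable a y M θ
    refine (ae_quenchedLaw_iff a y (p := fun x => x ∈ ⋃ M : ℕ, approximable a y M θ) hm).2 ?_
    filter_upwards [hy] with u hu
    have hpos := factorSeq_pos ha₀ ha₁ u fun i => hb.trans (hy' i).1
    obtain ⟨M, hM⟩ := exists_forall_partialProd_le hpos hu hθ hL
    obtain ⟨N, hN⟩ := exists_nat_ge (M / (1 - θ))
    refine mem_iUnion.2 ⟨N, ?_⟩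
    have := perpetuity_mem_approximable hpos hθ hθ₁ hM
    refine mem_iInter.2 fun n => ?_
    obtain ⟨w, hw⟩ := mem_iUnion.1 (mem_iInter.1 this n)
    refine mem_iUnion.2 ⟨w, hw.1, hw.2.trans ?_⟩
    gcongr
  · rw [dimH_iUnion]
    exact iSup_le fun M => dimH_approximable_le a y (Nat.cast_nonneg M) hθ hθ₁ hD

end UpperDimension

/-! ### Unboundedness of the logarithmic random walk -/

section Oscillation
open Set Filter Topology

/-- The filtration generated by the coordinates of a sequence: at time `n`, the coordinates with
index below `n` are known. -/
def coordFiltration (α : Type*) [MeasurableSpace α] :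
    Filtration ℕ (inferInstance : MeasurableSpace (ℕ → α)) where
  seq n := MeasurableSpace.comap (fun (x : ℕ → α) (i : Finset.range n) => x i) inferInstance
  mono' n k hnk := by
    have hm : Measurable fun (w : Finset.range k → α) (i : Finset.range n) =>
        w ⟨i, Finset.range_subset_range.2 hnk i.2⟩ := by fun_prop
    intro s ⟨t, ht, hts⟩
    exact ⟨_, hm ht, hts⟩
  le' n := Measurable.comap_le (by fun_prop)

/-- A centred random walk with bounded, non-trivial steps is almost surely unbounded above. -/
lemma ae_not_bddAbove_sum {α : Type*} [MeasurableSpace α] (p : Measure α)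
    [IsProbabilityMeasure p] {g : α → ℝ} (hg : Measurable g) {R : ℝ≥0} (hR : ∀ᵐ t ∂p, |g t| ≤ R)
    (hg0 : ∫ t, g t ∂p = 0) (hne : ¬ g =ᵐ[p] 0) :
    ∀ᵐ x ∂(Measure.infinitePi fun _ : ℕ => p),
      ¬ BddAbove (range fun n => ∑ i ∈ Finset.range n, g (x i)) := by
  set Q := Measure.infinitePi fun _ : ℕ => p with hQ
  have hint : Integrable g p := Integrable.of_bound hg.aestronglyMeasurable R hR
  have hev : ∀ i, MeasurePreserving (fun x : ℕ → α => x i) Q p :=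
    measurePreserving_eval_infinitePi fun _ : ℕ => p
  have hinti : ∀ i, Integrable (fun x : ℕ → α => g (x i)) Q := fun i =>
    (hev i).integrable_comp_of_integrable hint
  have hind := iIndepFun_infinitePi (P := fun _ : ℕ => p) (X := fun _ x => x)
    fun _ => measurable_id
  set f : ℕ → (ℕ → α) → ℝ := fun n x => ∑ i ∈ Finset.range n, g (x i) with hf
  have hadp : StronglyAdapted (coordFiltration α) f := by
    intro n
    refine Measurable.stronglyMeasurable ?_
    have e : f n = (fun w : Finset.range n → α => ∑ i : Finset.range n, g (w i)) ∘
        fun (x : ℕ → α) (i : Finset.range n) => x i := by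
      ext x
      simp only [hf, Function.comp]
      rw [← Finset.sum_coe_sort]
    rw [e]
    exact Measurable.comp (by fun_prop) (comap_measurable _)
  have hmart : Martingale f (coordFiltration α) Q := by
    refine martingale_of_condExp_sub_eq_zero_nat hadp
      (fun n => integrable_finsetSum _ fun i _ => hinti i) fun n => ?_
    have e : f (n + 1) - f n = fun x => g (x n) := by
      ext x; simp [hf, Finset.sum_range_succ]
    rw [e]
    have h1 := hind.indepFun_finset {n} (Finset.range n) (by simp) (fun i => by fun_prop)
    rw [IndepFun_iff_Indep] at h1
    have h2 := condExp_indep_eq (μ := Q) (f := fun x : ℕ → α => g (x n))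
      (Measurable.comap_le (by fun_prop)) ((coordFiltration α).le n)
      (Measurable.stronglyMeasurable ?_) h1
    · refine h2.trans (Eventually.of_forall fun x => ?_)
      have := (hev n).hasLaw.integral_comp (f := g) hg.aestronglyMeasurable
      simp only [Function.comp_def] at this
      simp only [this, hg0, Pi.zero_apply]
    · have e : (fun x : ℕ → α => g (x n)) =
          (fun w : ({n} : Finset ℕ) → α => g (w ⟨n, by simp⟩)) ∘
            fun (x : ℕ → α) (i : ({n} : Finset ℕ)) => x i := rfl
      rw [e]
      exact Measurable.comp (by fun_prop) (comap_measurable _)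
  have hstep : ∀ᵐ x ∂Q, ∀ i, |f (i + 1) x - f i x| ≤ R := by
    refine ae_all_iff.2 fun i => ?_
    filter_upwards [(hev i).quasiMeasurePreserving.ae hR] with x hx
    simpa [hf, Finset.sum_range_succ] using hx
  -- With bounded increments, a path bounded above converges almost surely. Its steps then tend to
  -- 0, and so do the averages of `|g|`; the strong law would give `∫ |g| = 0`.
  filter_upwards [hmart.submartingale.bddAbove_iff_exists_tendsto hstep,
    ae_tendsto_average_infinitePi p hg.abs hint.abs] with x h1 h2 hb
  obtain ⟨c, hc⟩ := h1.1 hb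
  have h3 : Tendsto (fun n => |g (x n)|) atTop (𝓝 0) := by
    have := ((hc.comp (tendsto_add_atTop_nat 1)).sub hc).abs
    simpa [hf, Finset.sum_range_succ] using this
  have h4 := h3.cesaro
  have h5 : ∫ t, |g t| ∂p = 0 := by
    refine tendsto_nhds_unique h2 (h4.congr fun n => ?_)
    rw [div_eq_inv_mul]
  rw [integral_eq_zero_iff_of_nonneg (fun _ => abs_nonneg _) hint.abs] at h5
  refine hne ?_
  filter_upwards [h5] with t ht
  simpa using ht

variable {η : Measure ℝ} [IsProbabilityMeasure η] {a b B : ℝ}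

lemma map_unzipSeq_coin :
    (Measure.infinitePi fun _ : ℕ => coin.prod η).map (unzipSeq Bool ℝ) =
      tossLaw.prod (errorLaw η) := map_unzipSeq coin η

/-- With `g` the centred negative log-factor, `log (2^n * P_n) = n * (L + log 2) - ∑ g`. The drift
is nonpositive and `∑ g` is unbounded above. At equality the drift vanishes and the strong law alone
would not decide. -/
lemma ae_exists_two_pow_mul_partialProd_le
    (ha₀ : 0 < a) (ha₁ : a < 1) (ha : 1 - a ^ 2 ≤ 1 / 4) (hb : 0 < b) (hη : ∀ᵐ x ∂η, x ∈ Ioo b B)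
    (hlog : ∫ x, Real.log x ∂η = 0) :
    ∀ᵐ x ∂tossLaw.prod (errorLaw η), ∀ ε > 0, ∃ n : ℕ,
      2 ^ n * partialProd (factorSeq a x.1 x.2) n ≤ ε := by
  set L := Real.log (1 - a ^ 2) / 2 with hL
  have hL2 : L + Real.log 2 ≤ 0 := by
    have h1 : Real.log (1 - a ^ 2) ≤ Real.log (1 / 4) := Real.log_le_log (by nlinarith) ha
    have h2 : Real.log (1 / 4) = -(2 * Real.log 2) := by
      rw [show (1 : ℝ) / 4 = (2 ^ 2)⁻¹ by norm_num, Real.log_inv, Real.log_pow]; norm_num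
    linarith
  let g : Bool × ℝ → ℝ := fun t => L - (Real.log (coinValue a t.1) + Real.log t.2)
  have hg : Measurable g := by fun_prop
  have hη' : ∀ᵐ t ∂coin.prod η, t.2 ∈ Ioo b B := Measure.quasiMeasurePreserving_snd.ae hη
  have hbd : ∃ R : ℝ≥0, ∀ᵐ t ∂coin.prod η, |g t| ≤ R := by
    refine ⟨⟨|L| + (|Real.log (1 - a)| + |Real.log (1 + a)|) + (|Real.log b| + |Real.log B|),
      by positivity⟩, ?_⟩
    filter_upwards [hη'] with t ht
    have h1 : |Real.log (coinValue a t.1)| ≤ |Real.log (1 - a)| + |Real.log (1 + a)| := by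
      cases t.1 <;> simp [coinValue]
    have h2 : |Real.log t.2| ≤ |Real.log b| + |Real.log B| := by
      have h3 := Real.log_le_log hb ht.1.le
      have h4 := Real.log_le_log (hb.trans ht.1) ht.2.le
      rw [abs_le]
      constructor
      · linarith [neg_abs_le (Real.log b), abs_nonneg (Real.log B)]
      · linarith [le_abs_self (Real.log B), abs_nonneg (Real.log b)]
    calc |g t| ≤ |L| + |Real.log (coinValue a t.1) + Real.log t.2| := abs_sub _ _
      _ ≤ |L| + (|Real.log (coinValue a t.1)| + |Real.log t.2|) := by
        gcongr; exact abs_add_le _ _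
      _ ≤ _ := by
        change _ ≤ |L| + (|Real.log (1 - a)| + |Real.log (1 + a)|) + (|Real.log b| + |Real.log B|)
        linarith
  obtain ⟨R, hR⟩ := hbd
  have hg0 : ∫ t, g t ∂coin.prod η = 0 := by
    have i1 : Integrable (fun t : Bool × ℝ => Real.log (coinValue a t.1)) (coin.prod η) :=
      (Integrable.of_finite (μ := coin) (f := fun b => Real.log (coinValue a b))).comp_fst η
    have i2 : Integrable (fun t : Bool × ℝ => Real.log t.2) (coin.prod η) :=
      (integrable_log hb hη).comp_snd coin
    have e1 : ∫ t : Bool × ℝ, Real.log (coinValue a t.1) ∂coin.prod η = L := by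
      rw [integral_fun_fst (fun b => Real.log (coinValue a b)), integral_log_coinValue ha₀ ha₁]
      simp [hL]
    have e2 : ∫ t : Bool × ℝ, Real.log t.2 ∂coin.prod η = 0 := by
      rw [integral_fun_snd (fun x => Real.log x), hlog]
      simp
    change ∫ t : Bool × ℝ, L - (Real.log (coinValue a t.1) + Real.log t.2) ∂coin.prod η = 0
    have i3 : Integrable (fun t : Bool × ℝ => Real.log (coinValue a t.1) + Real.log t.2)
      (coin.prod η) := i1.add i2
    rw [integral_sub (integrable_const _) i3, integral_add i1 i2, e1, e2]
    simp
  -- For a fixed error the two coin values give different values of `g`, and each has mass 1/2.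
  have hne : ¬ g =ᵐ[coin.prod η] 0 := by
    intro h
    have h1 := ae_ae_swap_of_ae_prod h
    obtain ⟨t, ht⟩ := h1.exists
    have h2 : ∀ c : Bool, g (c, t) = 0 := by
      intro c
      by_contra hc
      have h3 : coin {c} ≤ 0 :=
        (measure_mono (by rintro _ rfl; exact hc)).trans_eq (ae_iff.1 ht)
      rw [coin_singleton] at h3
      simp at h3
    have h3 := h2 true
    have h4 := h2 false
    simp only [g, coinValue] at h3 h4
    have h5 : Real.log (1 - a) < Real.log (1 + a) :=
      Real.log_lt_log (by linarith) (by linarith)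
    simp only [if_true, Bool.false_eq_true, if_false] at h3 h4
    linarith
  have key := ae_not_bddAbove_sum (coin.prod η) hg hR hg0 hne
  rw [← map_unzipSeq_coin, (unzipSeq Bool ℝ).measurableEmbedding.ae_map_iff]
  have hbox : ∀ᵐ x ∂(Measure.infinitePi fun _ : ℕ => coin.prod η), ∀ i, (x i).2 ∈ Ioo b B :=
    ae_all_iff.2 fun i => (measurePreserving_eval_infinitePi
      (fun _ : ℕ => coin.prod η) i).quasiMeasurePreserving.ae hη'
  filter_upwards [key, hbox] with x hx hbx ε hε
  have hpos : ∀ i, 0 < factorSeq a (unzipSeq Bool ℝ x).1 (unzipSeq Bool ℝ x).2 i :=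
    factorSeq_pos ha₀ ha₁ _ fun i => hb.trans (hbx i).1
  have h1 : ∃ n, -Real.log ε < ∑ i ∈ Finset.range n, g (x i) := by
    by_contra h
    push Not at h
    exact hx ⟨-Real.log ε, by rintro _ ⟨n, rfl⟩; exact h n⟩
  obtain ⟨n, hn⟩ := h1
  refine ⟨n, ?_⟩
  have hP := partialProd_pos hpos n
  rw [← Real.log_le_log_iff (by positivity) hε, Real.log_mul (by positivity) hP.ne', Real.log_pow,
    log_partialProd hpos]
  have h2 : ∑ i ∈ Finset.range n, g (x i) = n * L - ∑ i ∈ Finset.range n,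
      Real.log (factorSeq a (unzipSeq Bool ℝ x).1 (unzipSeq Bool ℝ x).2 i) := by
    simp only [g, Finset.sum_sub_distrib, Finset.sum_const, Finset.card_range, nsmul_eq_mul]
    congr 1
    refine Finset.sum_congr rfl fun i _ => ?_
    exact (Real.log_mul (coinValue_pos ha₀ ha₁ _).ne' (hb.trans (hbx i).1).ne').symm
  have h3 : (n : ℝ) * (L + Real.log 2) ≤ 0 :=
    mul_nonpos_of_nonneg_of_nonpos (Nat.cast_nonneg n) hL2
  nlinarith

end Oscillation

/-! ### Stopped words and a null carrier -/

section Singularity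
open Set Filter Topology

/-- The first time at which `2 ^ n` times the `n`-th partial product is at most `ε` is `n`. -/
def firstSmall (ε : ℝ) (n : ℕ) (z : ℕ → ℝ) : Prop :=
  2 ^ n * partialProd z n ≤ ε ∧ ∀ k < n, ε < 2 ^ k * partialProd z k

lemma exists_firstSmall {ε : ℝ} {z : ℕ → ℝ} (h : ∃ n, 2 ^ n * partialProd z n ≤ ε) :
    ∃ n, firstSmall ε n z := by
  classical
  exact ⟨Nat.find h, Nat.find_spec h, fun k hk => not_le.1 (Nat.find_min h hk)⟩

lemma firstSmall_unique {ε : ℝ} {z : ℕ → ℝ} {n k : ℕ} (hn : firstSmall ε n z)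
    (hk : firstSmall ε k z) : n = k := by
  rcases lt_trichotomy n k with h | h | h
  · exact absurd hn.1 (not_le.2 (hk.2 n h))
  · exact h
  · exact absurd hk.1 (not_le.2 (hn.2 k h))

/-- The stopping-time property: the first `n` factors decide the event. -/
lemma firstSmall_congr {ε : ℝ} {z z' : ℕ → ℝ} {n : ℕ} (h : ∀ i < n, z i = z' i)
    (hn : firstSmall ε n z) : firstSmall ε n z' := by
  refine ⟨partialProd_congr h ▸ hn.1, fun k hk => ?_⟩
  rw [← partialProd_congr fun i hi => h i (hi.trans hk)]
  exact hn.2 k hk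

lemma measurableSet_firstSmall (ε : ℝ) (n : ℕ) : MeasurableSet {z | firstSmall ε n z} := by
  have e : {z | firstSmall ε n z} = {z | 2 ^ n * partialProd z n ≤ ε} ∩
      ⋂ k : ℕ, ⋂ _ : k < n, {z | ε < 2 ^ k * partialProd z k} := by
    ext z; simp [firstSmall]
  rw [e]
  exact .inter (measurableSet_le (by fun_prop) measurable_const)
    (.iInter fun k => .iInter fun _ => measurableSet_lt measurable_const (by fun_prop))

lemma tsum_indicator_firstSmall_le (ε : ℝ) (z : ℕ → ℝ) :
    ∑' n, {z | firstSmall ε n z}.indicator (fun _ => (1 : ℝ≥0∞)) z ≤ 1 := by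
  by_cases h : ∃ n, firstSmall ε n z
  · obtain ⟨n, hn⟩ := h
    rw [tsum_eq_single n]
    · rw [indicator_of_mem (by exact hn)]
    · intro k hk
      exact indicator_of_notMem (s := {z | firstSmall ε k z})
        (fun h => hk (firstSmall_unique h hn)) _
  · push Not at h
    have : ∀ n, {z | firstSmall ε n z}.indicator (fun _ => (1 : ℝ≥0∞)) z = 0 := fun n =>
      indicator_of_notMem (s := {z | firstSmall ε n z}) (h n) _
    simp [this]

/-- A set which contains all sums whose tail after the first small product is at most `K`. -/
lemma exists_small_cover {a ε K : ℝ} (y : ℕ → ℝ) (hK : 0 ≤ K) :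
    ∃ A : Set ℝ, MeasurableSet A ∧ volume A ≤ ENNReal.ofReal (ε * K) ∧
      ∀ (u : ℕ → Bool) (n : ℕ) (x : ℝ), firstSmall ε n (factorSeq a u y) →
        x ∈ Icc (∑ i ∈ Finset.range n, partialProd (factorSeq a u y) i)
          (∑ i ∈ Finset.range n, partialProd (factorSeq a u y) i +
            partialProd (factorSeq a u y) n * K) → x ∈ A := by
  let J : ℕ → Set ((ℕ → Bool) × ℝ) := fun n => {w | firstSmall ε n (factorSeq a w.1 y) ∧
    ∑ i ∈ Finset.range n, partialProd (factorSeq a w.1 y) i ≤ w.2 ∧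
    w.2 ≤ ∑ i ∈ Finset.range n, partialProd (factorSeq a w.1 y) i +
      partialProd (factorSeq a w.1 y) n * K}
  have hz : Measurable fun w : (ℕ → Bool) × ℝ => factorSeq a w.1 y :=
    (measurable_factorSeq_left a y).comp measurable_fst
  have hJ : ∀ n, MeasurableSet (J n) := fun n => by
    refine MeasurableSet.inter ((measurableSet_firstSmall ε n).preimage hz) (.inter ?_ ?_)
    · exact measurableSet_le (Finset.measurable_sum _ fun i _ =>
        (measurable_partialProd i).comp hz) measurable_snd
    · exact measurableSet_le measurable_snd ((Finset.measurable_sum _ fun i _ =>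
        (measurable_partialProd i).comp hz).add (((measurable_partialProd n).comp hz).mul_const K))
  let F : (ℕ → Bool) × ℝ → ℝ≥0∞ := fun w => ∑' n : ℕ, (J n).indicator (fun _ => 2 ^ n) w
  have hF : Measurable F := Measurable.tsum fun n => measurable_const.indicator (hJ n)
  -- A stopped word of length `n` whose interval contains `x` contributes `2^n * 2^(-n) = 1`, so `h
  -- x` counts such words and `{1 ≤ h}` is the union of the intervals. For fixed `u` at most one `n`
  -- is a stopping time, which bounds `∫ h` by `ε * K`.
  let h : ℝ → ℝ≥0∞ := fun x => ∫⁻ u, F (u, x) ∂tossLaw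
  have hh : Measurable h := hF.lintegral_prod_left'
  refine ⟨{x | 1 ≤ h x}, measurableSet_le measurable_const hh, ?_, ?_⟩
  · calc volume {x | 1 ≤ h x} ≤ ∫⁻ x, h x := by
          simpa using mul_meas_ge_le_lintegral hh (μ := (volume : Measure ℝ)) 1
      _ = ∫⁻ u, (∫⁻ x : ℝ, F (u, x)) ∂tossLaw :=
        lintegral_lintegral_swap (f := fun x u => F (u, x)) (hF.comp measurable_swap).aemeasurable
      _ ≤ ∫⁻ _, ENNReal.ofReal (ε * K) ∂tossLaw := lintegral_mono fun u => ?_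
      _ = _ := by simp
    have hJu : ∀ n, MeasurableSet {x : ℝ | (u, x) ∈ J n} := fun n =>
      (hJ n).preimage measurable_prodMk_left
    calc ∫⁻ x, F (u, x) = ∑' n : ℕ, 2 ^ n * volume {x : ℝ | (u, x) ∈ J n} := by
          change ∫⁻ x, ∑' n : ℕ, {x : ℝ | (u, x) ∈ J n}.indicator (fun _ => (2 : ℝ≥0∞) ^ n) x = _
          rw [lintegral_tsum fun n => (measurable_const.indicator (hJu n)).aemeasurable]
          refine tsum_congr fun n => ?_
          exact lintegral_indicator_const (hJu n) _
      _ ≤ ∑' n : ℕ, ENNReal.ofReal (ε * K) *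
          {z | firstSmall ε n z}.indicator (fun _ => (1 : ℝ≥0∞)) (factorSeq a u y) := by
        refine ENNReal.tsum_le_tsum fun n => ?_
        by_cases hs : firstSmall ε n (factorSeq a u y)
        · rw [indicator_of_mem (by exact hs), mul_one]
          calc 2 ^ n * volume {x : ℝ | (u, x) ∈ J n} ≤
              ENNReal.ofReal (2 ^ n) * ENNReal.ofReal (partialProd (factorSeq a u y) n * K) := by
                rw [ENNReal.ofReal_pow (by norm_num), ENNReal.ofReal_ofNat]
                gcongr
                calc _ ≤ volume (Icc (∑ i ∈ Finset.range n, partialProd (factorSeq a u y) i)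
                      (∑ i ∈ Finset.range n, partialProd (factorSeq a u y) i +
                        partialProd (factorSeq a u y) n * K)) :=
                      measure_mono fun x hx => ⟨hx.2.1, hx.2.2⟩
                  _ = _ := by rw [Real.volume_Icc, add_sub_cancel_left]
            _ = ENNReal.ofReal (2 ^ n * (partialProd (factorSeq a u y) n * K)) :=
              (ENNReal.ofReal_mul (by positivity)).symm
            _ ≤ _ := by
              refine ENNReal.ofReal_le_ofReal ?_
              rw [← mul_assoc]
              exact mul_le_mul_of_nonneg_right hs.1 hK
        · have : {x : ℝ | (u, x) ∈ J n} = ∅ := eq_empty_of_forall_notMem fun x hx => hs hx.1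
          simp [this]
      _ ≤ _ := by
        rw [ENNReal.tsum_mul_left]
        exact (mul_le_mul_right (tsum_indicator_firstSmall_le ε _) _).trans_eq (mul_one _)
  · intro u n x hs hx
    change 1 ≤ ∫⁻ v, F (v, x) ∂tossLaw
    calc (1 : ℝ≥0∞) = 2 ^ n * tossLaw {v | ∀ i < n, u i = v i} := by
          rw [tossLaw_agree, ← mul_pow, ENNReal.mul_inv_cancel (by simp) (by simp), one_pow]
      _ = ∫⁻ v, {v : ℕ → Bool | ∀ i < n, u i = v i}.indicator (fun _ => (2 : ℝ≥0∞) ^ n) v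
          ∂tossLaw := (lintegral_indicator_const (measurableSet_agree u n) _).symm
      _ ≤ _ := lintegral_mono fun v => ?_
    by_cases hv : ∀ i < n, u i = v i
    · rw [indicator_of_mem (by exact hv)]
      have hzz : ∀ i < n, factorSeq a u y i = factorSeq a v y i := fun i hi => by
        simp only [factorSeq, hv i hi]
      have e : ∑ i ∈ Finset.range n, partialProd (factorSeq a v y) i =
          ∑ i ∈ Finset.range n, partialProd (factorSeq a u y) i :=
        Finset.sum_congr rfl fun i hi => (partialProd_congr fun j hj =>
          hzz j (hj.trans (Finset.mem_range.1 hi))).symm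
      have hmem : (v, x) ∈ J n := by
        refine ⟨firstSmall_congr hzz hs, ?_, ?_⟩
        · simpa only [e] using hx.1
        · simpa only [e, partialProd_congr hzz] using hx.2
      refine le_trans ?_ (ENNReal.le_tsum n)
      rw [indicator_of_mem hmem]
    · rw [indicator_of_notMem (by exact hv)]
      exact zero_le

variable {η : Measure ℝ} [IsProbabilityMeasure η] {a b B : ℝ}

/-- The tail of the series at the first small product has at most the law of the whole series. -/
lemma measure_firstSmall_tail_le (ε K : ℝ) :
    (tossLaw.prod (errorLaw η)) {x | ∃ n, firstSmall ε n (factorSeq a x.1 x.2) ∧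
      K < perpetuity (fun i => factorSeq a x.1 x.2 (i + n))} ≤
    (tossLaw.prod (errorLaw η)) {x | K < perpetuity (factorSeq a x.1 x.2)} := by
  rw [← map_unzipSeq_coin, MeasurableEquiv.map_apply, MeasurableEquiv.map_apply]
  set Q := Measure.infinitePi fun _ : ℕ => coin.prod η with hQ
  let Z : (ℕ → Bool × ℝ) → ℕ → ℝ := fun x i => coinValue a (x i).1 * (x i).2
  have hZ : Measurable Z := by fun_prop
  have hTm : MeasurableSet {x | K < perpetuity (Z x)} :=
    measurableSet_lt measurable_const (measurable_perpetuity.comp hZ)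
  have hHm : ∀ n, MeasurableSet {x | firstSmall ε n (Z x)} := fun n =>
    (measurableSet_firstSmall ε n).preimage hZ
  have hsm : ∀ n, Measurable fun x => fun i => Z x (i + n) := fun n => by fun_prop
  -- The strong Markov property: stopping at `n` concerns the past only, and the future can be
  -- replaced by an independent copy.
  have hn : ∀ n, Q {x | firstSmall ε n (Z x) ∧ K < perpetuity (fun i => Z x (i + n))} =
      Q {x | firstSmall ε n (Z x)} * Q {x | K < perpetuity (Z x)} := by
    intro n
    have hm : MeasurableSet {x | firstSmall ε n (Z x) ∧ K < perpetuity (fun i => Z x (i + n))} :=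
      (hHm n).inter (measurableSet_lt measurable_const (measurable_perpetuity.comp (hsm n)))
    rw [← Measure.prod_prod, hQ]
    nth_rw 1 [← map_concatSeq_infinitePi (coin.prod η) n]
    rw [Measure.map_apply (measurable_concatSeq n) hm]
    congr 1
    ext ⟨x, x'⟩
    have e1 : ∀ i < n, Z (concatSeq n x x') i = Z x i := fun i hi => by simp [Z, concatSeq, hi]
    have e2 : (fun i => Z (concatSeq n x x') (i + n)) = Z x' := by
      ext i; simp [Z, concatSeq]
    simp only [mem_preimage, mem_ofPred_eq, mem_prod, e2]
    exact and_congr_left fun _ => ⟨firstSmall_congr e1, firstSmall_congr fun i hi => (e1 i hi).symm⟩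
  have hsum : ∑' n, Q {x | firstSmall ε n (Z x)} ≤ 1 := by
    calc ∑' n, Q {x | firstSmall ε n (Z x)} = Q (⋃ n, {x | firstSmall ε n (Z x)}) := by
          refine (measure_iUnion (fun i j hij => ?_) hHm).symm
          exact disjoint_left.2 fun x hi hj => hij (firstSmall_unique hi hj)
      _ ≤ 1 := prob_le_one
  calc _ ≤ Q (⋃ n, {x | firstSmall ε n (Z x) ∧ K < perpetuity (fun i => Z x (i + n))}) := by
        refine measure_mono ?_
        rintro x ⟨n, h1, h2⟩
        exact mem_iUnion.2 ⟨n, h1, h2⟩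
    _ ≤ ∑' n, Q {x | firstSmall ε n (Z x) ∧ K < perpetuity (fun i => Z x (i + n))} :=
      measure_iUnion_le _
    _ = (∑' n, Q {x | firstSmall ε n (Z x)}) * Q {x | K < perpetuity (Z x)} := by
      rw [← ENNReal.tsum_mul_right]; exact tsum_congr hn
    _ ≤ 1 * Q {x | K < perpetuity (Z x)} := by gcongr
    _ = _ := one_mul _

lemma exists_tail_le {α : Type*} [MeasurableSpace α] (μ : Measure α) [IsProbabilityMeasure μ]
    {f : α → ℝ} (hf : Measurable f) {δ : ℝ≥0∞} (hδ : 0 < δ) :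
    ∃ K : ℝ, 0 ≤ K ∧ μ {x | K < f x} ≤ δ := by
  have h : Tendsto (fun n : ℕ => μ {x | (n : ℝ) < f x}) atTop
      (𝓝 (μ (⋂ n : ℕ, {x | (n : ℝ) < f x}))) := by
    refine tendsto_measure_iInter_atTop
      (fun n => (measurableSet_lt measurable_const hf).nullMeasurableSet) ?_ ⟨0, by simp⟩
    intro n k hnk x hx
    have hx' : (k : ℝ) < f x := hx
    exact (Nat.cast_le.2 hnk).trans_lt hx'
  have h0 : (⋂ n : ℕ, {x | (n : ℝ) < f x}) = ∅ := by
    refine eq_empty_of_forall_notMem fun x hx => ?_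
    obtain ⟨n, hn⟩ := exists_nat_gt (f x)
    exact absurd (mem_iInter.1 hx n) (not_lt.2 hn.le)
  rw [h0, measure_empty] at h
  obtain ⟨n, hn⟩ := (h.eventually (gt_mem_nhds hδ)).exists
  exact ⟨n, Nat.cast_nonneg n, hn.le⟩

/-- Borel–Cantelli is used twice: almost surely the stopped tail eventually stays below `K j`, so
the sum eventually lies in the cover `A j`; and the covers have summable volumes, so their limsup is
null. -/
lemma ae_quenchedLaw_mutuallySingular
    (ha₀ : 0 < a) (ha₁ : a < 1) (ha : 1 - a ^ 2 ≤ 1 / 4) (hb : 0 < b) (hη : ∀ᵐ x ∂η, x ∈ Ioo b B)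
    (hlog : ∫ x, Real.log x ∂η = 0) :
    ∀ᵐ y ∂errorLaw η, quenchedLaw a y ⟂ₘ volume := by
  have hX : Measurable fun x : (ℕ → Bool) × (ℕ → ℝ) => perpetuity (factorSeq a x.1 x.2) :=
    measurable_perpetuity.comp (measurable_factorSeq a)
  choose K hK0 hK using fun j : ℕ => exists_tail_le (tossLaw.prod (errorLaw η)) hX
    (δ := 2⁻¹ ^ j) (ENNReal.pow_pos (by simp) j)
  -- Chosen after `K j` so that the cover has volume at most `ε j * K j ≤ 2^(-j)`.
  let ε : ℕ → ℝ := fun j => (1 / 2) ^ j / (K j + 1)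
  have hε : ∀ j, 0 < ε j := fun j => by have := hK0 j; positivity
  have hεK : ∀ j, ε j * K j ≤ (1 / 2) ^ j := fun j => by
    have h1 := hK0 j
    rw [div_mul_eq_mul_div, div_le_iff₀ (by linarith)]
    have : (0 : ℝ) < (1 / 2) ^ j := by positivity
    nlinarith
  have hsum : ∑' j : ℕ, (2⁻¹ : ℝ≥0∞) ^ j ≠ ∞ := by
    rw [ENNReal.tsum_geometric, ENNReal.one_sub_inv_two]; simp
  have hbad : ∀ᵐ x ∂tossLaw.prod (errorLaw η), ∀ᶠ j in atTop, ¬ ∃ n,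
      firstSmall (ε j) n (factorSeq a x.1 x.2) ∧
        K j < perpetuity (fun i => factorSeq a x.1 x.2 (i + n)) := by
    refine ae_eventually_notMem (ne_top_of_le_ne_top hsum (ENNReal.tsum_le_tsum fun j => ?_))
    exact (measure_firstSmall_tail_le (ε j) (K j)).trans (hK j)
  have hlow := ae_exists_two_pow_mul_partialProd_le ha₀ ha₁ ha hb hη hlog
  have hconv := ae_perpetuityENN_ne_top ha₀ ha₁ hb hη hlog
  filter_upwards [ae_ae_swap_of_ae_prod hbad, ae_ae_swap_of_ae_prod hlow,
    ae_ae_swap_of_ae_prod hconv, errorLaw_ae_of_ae hη] with y h1 h2 h3 h4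
  choose A hAm hAv hA using fun j : ℕ => exists_small_cover (a := a) (ε := ε j) y (hK0 j)
  have hnull : volume (limsup A atTop) = 0 := by
    refine measure_limsup_atTop_eq_zero (ne_top_of_le_ne_top hsum
      (ENNReal.tsum_le_tsum fun j => (hAv j).trans ?_))
    refine (ENNReal.ofReal_le_ofReal (hεK j)).trans_eq ?_
    rw [ENNReal.ofReal_pow (by norm_num)]
    congr 1
    rw [one_div, ENNReal.ofReal_inv_of_pos (by norm_num), ENNReal.ofReal_ofNat]
  have hmeas : MeasurableSet (limsup A atTop) := MeasurableSet.measurableSet_limsup hAm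
  refine ⟨(limsup A atTop)ᶜ, hmeas.compl, ?_, by rwa [compl_compl]⟩
  change ∀ᵐ x ∂quenchedLaw a y, x ∈ limsup A atTop
  refine (ae_quenchedLaw_iff a y (p := fun x => x ∈ limsup A atTop) hmeas).2 ?_
  filter_upwards [h1, h2, h3] with u h1 h2 h3
  have hpos := factorSeq_pos ha₀ ha₁ u fun i => hb.trans (h4 i).1
  rw [mem_limsup_iff_frequently_mem]
  refine Eventually.frequently ?_
  filter_upwards [h1] with j hj
  obtain ⟨n, hn⟩ := exists_firstSmall (h2 (ε j) (hε j))
  have htail : perpetuity (fun i => factorSeq a u y (i + n)) ≤ K j := by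
    by_contra h
    exact hj ⟨n, hn, not_le.1 h⟩
  refine hA j u n _ hn ?_
  rw [perpetuity_eq_add hpos h3 n]
  have hP := partialProd_pos hpos n
  refine ⟨by linarith [mul_nonneg hP.le (perpetuity_nonneg fun i => factorSeq a u y (i + n))], ?_⟩
  gcongr

end Singularity

/-! ### Identification of the conditional law -/

section ConditionalLaw
open Set Filter Topology

instance (a : ℝ) : IsProbabilityMeasure (fairChoice a) := by
  rw [fairChoice_eq_map]
  exact Measure.isProbabilityMeasure_map (measurable_coinValue a).aemeasurable

variable {Ω : Type*} [MeasurableSpace Ω] {P : Measure Ω}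

lemma map_prodMk_eq_prod_infinitePi {p q : Measure ℝ} [IsProbabilityMeasure p]
    [IsProbabilityMeasure q] {U V : ℕ → Ω → ℝ} (hU : ∀ i, HasLaw (U i) p P)
    (hV : ∀ i, HasLaw (V i) q P) (hindep : iIndepFun (Sum.elim U V) P) :
    P.map (fun ω => ((fun i => U i ω), fun i => V i ω)) =
      (Measure.infinitePi fun _ : ℕ => p).prod (Measure.infinitePi fun _ : ℕ => q) := by
  have hUm : AEMeasurable (fun ω i => U i ω) P := aemeasurable_pi_iff.2 fun i => (hU i).aemeasurable
  have hVm : AEMeasurable (fun ω i => V i ω) P := aemeasurable_pi_iff.2 fun i => (hV i).aemeasurable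
  refine (prod_infinitePi_eq_of_boxes p q _ fun I s t hs ht => ?_).symm
  rw [Measure.map_apply_of_aemeasurable (hUm.prodMk hVm)
    ((MeasurableSet.pi I.countable_toSet fun i _ => hs i).prod
      (MeasurableSet.pi I.countable_toSet fun i _ => ht i))]
  have h := hindep.measure_inter_preimage_eq_mul (I.disjSum I)
    (sets := Sum.elim s t) (by rintro (i | i) _; exacts [hs i, ht i])
  rw [Finset.prod_disjSum] at h
  have e1 : ∀ i, P (Sum.elim U V (Sum.inl i) ⁻¹' Sum.elim s t (Sum.inl i)) = p (s i) := fun i => by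
    rw [← (hU i).map_eq, Measure.map_apply_of_aemeasurable (hU i).aemeasurable (hs i)]
    rfl
  have e2 : ∀ i, P (Sum.elim U V (Sum.inr i) ⁻¹' Sum.elim s t (Sum.inr i)) = q (t i) := fun i => by
    rw [← (hV i).map_eq, Measure.map_apply_of_aemeasurable (hV i).aemeasurable (ht i)]
    rfl
  simp only [e1, e2] at h
  rw [← h]
  congr 1
  ext ω
  simp [Set.mem_pi]

lemma map_coinValue_prod (a : ℝ) (η : Measure ℝ) [IsProbabilityMeasure η] :
    (tossLaw.prod (errorLaw η)).map (fun x => ((fun i => coinValue a (x.1 i)), x.2)) =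
      (Measure.infinitePi fun _ : ℕ => fairChoice a).prod (errorLaw η) := by
  have h : tossLaw.map (fun u i => coinValue a (u i)) =
      Measure.infinitePi fun _ : ℕ => fairChoice a := by
    rw [tossLaw, Measure.infinitePi_map_pi _ fun _ => measurable_coinValue a]
    simp only [fairChoice_eq_map]
  rw [← h]
  conv_rhs => rw [← Measure.map_id (μ := errorLaw η)]
  rw [Measure.map_prod_map _ _ (by fun_prop) measurable_id]
  rfl

/-- The conditional laws of the series as a Markov kernel. -/
noncomputable def quenchedKernel (a : ℝ) : Kernel (ℕ → ℝ) ℝ where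
  toFun := quenchedLaw a
  measurable' := by
    refine Measure.measurable_of_measurable_coe _ fun s hs => ?_
    have hm : MeasurableSet {x : (ℕ → ℝ) × (ℕ → Bool) | perpetuity (factorSeq a x.2 x.1) ∈ s} :=
      (measurable_perpetuity.comp ((measurable_factorSeq a).comp measurable_swap)) hs
    have e : (fun y => quenchedLaw a y s) = fun y => tossLaw (Prod.mk y ⁻¹'
        {x : (ℕ → ℝ) × (ℕ → Bool) | perpetuity (factorSeq a x.2 x.1) ∈ s}) := by
      ext y
      rw [quenchedLaw, Measure.map_apply (by fun_prop) hs]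
      rfl
    rw [e]
    exact measurable_measure_prodMk_left hm

instance (a : ℝ) : IsMarkovKernel (quenchedKernel a) :=
  ⟨fun y => inferInstanceAs (IsProbabilityMeasure (quenchedLaw a y))⟩

lemma map_perpetuity_eq_compProd (a : ℝ) (η : Measure ℝ) [IsProbabilityMeasure η] :
    (tossLaw.prod (errorLaw η)).map (fun x => (x.2, perpetuity (factorSeq a x.1 x.2))) =
      errorLaw η ⊗ₘ quenchedKernel a := by
  have hm : Measurable fun x : (ℕ → Bool) × (ℕ → ℝ) => (x.2, perpetuity (factorSeq a x.1 x.2)) :=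
    measurable_snd.prodMk (measurable_perpetuity.comp (measurable_factorSeq a))
  ext s hs
  rw [Measure.map_apply hm hs, Measure.prod_apply_symm (hm hs), Measure.compProd_apply hs]
  refine lintegral_congr fun y => ?_
  change _ = quenchedLaw a y _
  rw [quenchedLaw, Measure.map_apply (by fun_prop) (hs.preimage measurable_prodMk_left)]
  rfl

variable {η : Measure ℝ} [IsProbabilityMeasure η] {a b B : ℝ} {lam Y : ℕ → Ω → ℝ}

/-- Transfers almost sure statements from the coin-and-error model to the given probability space.
-/
lemma ae_of_ae_tossLaw_prod (hlam : ∀ i, HasLaw (lam i) (fairChoice a) P)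
    (hY : ∀ i, HasLaw (Y i) η P) (hindep : iIndepFun (Sum.elim lam Y) P)
    {p : (ℕ → ℝ) → Prop} (hp : MeasurableSet {z | p z})
    (h : ∀ᵐ x ∂tossLaw.prod (errorLaw η), p (factorSeq a x.1 x.2)) :
    ∀ᵐ ω ∂P, p fun i => lam i ω * Y i ω := by
  have hmul : Measurable fun x : (ℕ → ℝ) × (ℕ → ℝ) => fun i => x.1 i * x.2 i := by fun_prop
  have hc : Measurable fun x : (ℕ → Bool) × (ℕ → ℝ) =>
    (((fun i => coinValue a (x.1 i)), x.2) : (ℕ → ℝ) × (ℕ → ℝ)) := by fun_prop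
  have h1 := (ae_map_iff (p := fun x : (ℕ → ℝ) × (ℕ → ℝ) => p fun i => x.1 i * x.2 i)
    hc.aemeasurable (hp.preimage hmul)).2 h
  rw [map_coinValue_prod, errorLaw, ← map_prodMk_eq_prod_infinitePi hlam hY hindep] at h1
  exact ae_of_ae_map ((aemeasurable_pi_iff.2 fun i => (hlam i).aemeasurable).prodMk
    (aemeasurable_pi_iff.2 fun i => (hY i).aemeasurable)) h1

/-- `quenchedKernel a` disintegrates the joint law of errors and sum, and conditional distributions
are almost everywhere unique. The factors are positive almost surely, so replacing `seriesSum` by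
`perpetuity` changes nothing. -/
lemma condSeriesLaw_ae_eq [IsProbabilityMeasure P]
    (hlam : ∀ i, HasLaw (lam i) (fairChoice a) P)
    (hY : ∀ i, HasLaw (Y i) η P) (hindep : iIndepFun (Sum.elim lam Y) P)
    (ha₀ : 0 < a) (ha₁ : a < 1) (hb : 0 < b) (hη : ∀ᵐ x ∂η, x ∈ Ioo b B) :
    ∀ᵐ y ∂errorLaw η, condSeriesLaw P lam Y y = quenchedLaw a y := by
  have hlm : AEMeasurable (fun ω i => lam i ω) P :=
    aemeasurable_pi_iff.2 fun i => (hlam i).aemeasurable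
  have hYm : AEMeasurable (fun ω i => Y i ω) P :=
    aemeasurable_pi_iff.2 fun i => (hY i).aemeasurable
  have hlaw := map_prodMk_eq_prod_infinitePi hlam hY hindep
  rw [show (Measure.infinitePi fun _ : ℕ => η) = errorLaw η from rfl, ← map_coinValue_prod] at hlaw
  have hpos : ∀ᵐ ω ∂P, ∀ i, 0 < lam i ω * Y i ω := by
    refine ae_of_ae_tossLaw_prod hlam hY hindep (p := fun z => ∀ i, 0 < z i) ?_ ?_
    · rw [ofPred_forall]
      exact .iInter fun i => measurableSet_lt measurable_const (measurable_pi_apply i)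
    · filter_upwards [Measure.quasiMeasurePreserving_snd.ae (errorLaw_ae_of_ae hη)] with x hx
      exact factorSeq_pos ha₀ ha₁ x.1 fun i => hb.trans (hx i).1
  have hX : (seriesSum fun i ω => lam i ω * Y i ω) =ᵐ[P]
      fun ω => perpetuity fun i => lam i ω * Y i ω := by
    filter_upwards [hpos] with ω hω
    exact (perpetuity_eq_tsum hω).symm
  have hf : Measurable fun x : (ℕ → ℝ) × (ℕ → ℝ) => (x.2, perpetuity fun i => x.1 i * x.2 i) :=
    measurable_snd.prodMk (measurable_perpetuity.comp (by fun_prop))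
  have hc : Measurable fun x : (ℕ → Bool) × (ℕ → ℝ) =>
    (((fun i => coinValue a (x.1 i)), x.2) : (ℕ → ℝ) × (ℕ → ℝ)) := by fun_prop
  have hXm : AEMeasurable (fun ω => perpetuity fun i => lam i ω * Y i ω) P :=
    measurable_perpetuity.comp_aemeasurable
      (aemeasurable_pi_iff.2 fun i => (hlam i).aemeasurable.mul (hY i).aemeasurable)
  have hY' : P.map (fun ω i => Y i ω) = errorLaw η := by
    have h1 := congrArg Measure.snd hlaw
    rw [map_coinValue_prod, Measure.snd_prod, Measure.snd,
      AEMeasurable.map_map_of_aemeasurable measurable_snd.aemeasurable (hlm.prodMk hYm)] at h1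
    exact h1
  have hjoint : P.map (fun ω => ((fun i => Y i ω), perpetuity fun i => lam i ω * Y i ω)) =
      P.map (fun ω i => Y i ω) ⊗ₘ quenchedKernel a := by
    rw [hY', ← map_perpetuity_eq_compProd]
    have h1 := congrArg (Measure.map
      fun x : (ℕ → ℝ) × (ℕ → ℝ) => (x.2, perpetuity fun i => x.1 i * x.2 i)) hlaw
    rw [AEMeasurable.map_map_of_aemeasurable hf.aemeasurable (hlm.prodMk hYm),
      Measure.map_map hf hc] at h1
    exact h1
  have h := condDistrib_ae_eq_of_measure_eq_compProd (μ := P) (fun ω i => Y i ω) hXm hjoint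
  rw [← hY']
  filter_upwards [h] with y hy
  rw [condSeriesLaw, condDistrib_congr_left hX]
  exact hy

end ConditionalLaw

/-! ### Choice of exponents and conclusion -/

section MainTheorem
open Set Filter Topology

variable {η : Measure ℝ} [IsProbabilityMeasure η] {C : ℝ≥0} {a b B : ℝ}

lemma ae_exists_forall_le_partialProd
    (ha₀ : 0 < a) (ha₁ : a < 1) (hb : 0 < b) (hη : ∀ᵐ x ∂η, x ∈ Ioo b B)
    (hlog : ∫ x, Real.log x ∂η = 0) {l : ℝ} (hl : l < Real.log (1 - a ^ 2) / 2) :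
    ∀ᵐ x ∂tossLaw.prod (errorLaw η), ∃ N : ℕ, ∀ n,
      1 / ((N : ℝ) + 1) * Real.exp l ^ n ≤ partialProd (factorSeq a x.1 x.2) n := by
  filter_upwards [ae_tendsto_log_partialProd ha₀ ha₁ hb hη hlog,
    Measure.quasiMeasurePreserving_snd.ae (errorLaw_ae_of_ae hη)] with x h1 h2
  exact exists_forall_le_partialProd (factorSeq_pos ha₀ ha₁ x.1 fun i => hb.trans (h2 i).1) h1
    (Real.exp_pos l) (by rwa [Real.log_exp])

lemma half_log_one_quarter : Real.log (1 / 4) / 2 = -Real.log 2 := by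
  rw [show (1 : ℝ) / 4 = (2 ^ 2)⁻¹ by norm_num, Real.log_inv, Real.log_pow]
  push_cast
  ring

/-- The value is `d = log 2 / (-L)`, the solution of `2 * exp (L * d) = 1`. The hypothesis on `a`
gives `d ≤ 1`, as the mean estimate requires exponents at most 1. -/
lemma ae_measureDimH_quenchedLaw_eq
    (hC : ∀ s, η s ≤ C * volume s) (ha₀ : 0 < a) (ha₁ : a < 1) (ha : 1 - a ^ 2 ≤ 1 / 4)
    (hb : 0 < b) (hB : 0 < B) (hη : ∀ᵐ x ∂η, x ∈ Ioo b B) (hlog : ∫ x, Real.log x ∂η = 0) :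
    ∀ᵐ y ∂errorLaw η, measureDimH (quenchedLaw a y) =
      ENNReal.ofReal (2 * Real.log 2 / Real.log (1 / (1 - a ^ 2))) := by
  set L := Real.log (1 - a ^ 2) / 2 with hL
  have h2 : 0 < Real.log 2 := Real.log_pos (by norm_num)
  have hL2 : L ≤ -Real.log 2 := by
    rw [← half_log_one_quarter, hL]
    have := Real.log_le_log (show 0 < 1 - a ^ 2 by nlinarith) ha
    linarith
  have hL0 : L < 0 := by linarith
  have hd : 2 * Real.log 2 / Real.log (1 / (1 - a ^ 2)) = Real.log 2 / -L := by
    rw [one_div, Real.log_inv, show Real.log (1 - a ^ 2) = 2 * L by rw [hL]; ring]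
    rw [show -(2 * L) = 2 * -L by ring, mul_div_mul_left _ _ two_ne_zero]
  rw [hd]
  set d : ℝ≥0 := (Real.log 2 / -L).toNNReal with hdn
  have hdpos : 0 < Real.log 2 / -L := div_pos h2 (by linarith)
  have hdr : (d : ℝ) = Real.log 2 / -L := Real.coe_toNNReal _ hdpos.le
  have hd1 : Real.log 2 / -L ≤ 1 := by rw [div_le_one (by linarith)]; linarith
  have hconv := ae_perpetuityENN_ne_top ha₀ ha₁ hb hη hlog
  have hlow : ∀ t : ℝ≥0, 0 < t → t < d →
      ∀ᵐ y ∂errorLaw η, (t : ℝ≥0∞) ≤ measureDimH (quenchedLaw a y) := by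
    intro t ht htd
    obtain ⟨s, hts, hsd⟩ := exists_between (NNReal.coe_lt_coe.2 htd)
    rw [hdr] at hsd
    have hs0 : 0 < s := lt_trans (NNReal.coe_pos.2 ht) hts
    have hlt : -Real.log 2 / s < L := by
      rw [lt_div_iff₀ (by linarith)] at hsd
      rw [div_lt_iff₀ hs0]
      linarith
    -- With `θ = exp l`, `l < L` gives the growth bound and `l > -log 2 / s` gives `2 * θ^s > 1`.
    obtain ⟨l, hl1, hl2⟩ := exists_between hlt
    refine ae_le_measureDimH_quenchedLaw hC ha₀ ha₁ hb hB hη hconv ht hts (hsd.le.trans hd1)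
      (Real.exp_pos l) ?_ (ae_exists_forall_le_partialProd ha₀ ha₁ hb hη hlog hl2)
    rw [← Real.exp_mul]
    nth_rw 1 [← Real.exp_log two_pos]
    rw [← Real.exp_add, Real.one_lt_exp_iff]
    rw [div_lt_iff₀ hs0] at hl1
    linarith
  have hup : ∀ D : ℝ≥0, d < D → ∀ᵐ y ∂errorLaw η, measureDimH (quenchedLaw a y) ≤ D := by
    intro D hD
    have hD' := NNReal.coe_lt_coe.2 hD
    rw [hdr] at hD'
    have hD0 : (0 : ℝ) < D := hdpos.trans hD'
    have hl0 : -Real.log 2 / D < 0 := div_neg_of_neg_of_pos (by linarith) hD0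
    -- This `θ` makes `2 * θ^D = 1`; `D > d` places its logarithm above `L`.
    refine ae_measureDimH_quenchedLaw_le ha₀ ha₁ hb hη hlog
      (Real.exp_pos (-Real.log 2 / D)) ?_ ?_ ?_
    · exact (Real.exp_lt_exp.2 hl0).trans_eq Real.exp_zero
    · rw [← hL, Real.log_exp, lt_div_iff₀ hD0]
      rw [div_lt_iff₀ (by linarith)] at hD'
      linarith
    · rw [← Real.exp_mul, div_mul_cancel₀ _ hD0.ne', Real.exp_neg, Real.exp_log two_pos]
      norm_num
  have hd0 : 0 < d := by rw [← NNReal.coe_pos, hdr]; exact hdpos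
  -- Sequences of exponents converging to `d` leave only countably many exceptional null sets.
  obtain ⟨t, -, htd, htl⟩ := exists_seq_strictMono_tendsto' hd0
  obtain ⟨D, -, hDd, hDl⟩ := exists_seq_strictAnti_tendsto d
  have h3 := ae_all_iff.2 fun n => hlow (t n) (htd n).1 (htd n).2
  have h4 := ae_all_iff.2 fun n => hup (D n) (hDd n)
  filter_upwards [h3, h4] with y h3 h4
  exact le_antisymm (ge_of_tendsto' (ENNReal.tendsto_coe.2 hDl) h4)
    (le_of_tendsto' (ENNReal.tendsto_coe.2 htl) h3)

/-- The hypothesis says `exp L > 1 / 2`, which leaves room for a growth rate `θ` strictly between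
the two. -/
lemma ae_quenchedLaw_absolutelyContinuous_of_lt
    (hC : ∀ s, η s ≤ C * volume s) (ha₀ : 0 < a) (ha₁ : a < 1) (ha : 1 / 4 < 1 - a ^ 2)
    (hb : 0 < b) (hB : 0 < B) (hη : ∀ᵐ x ∂η, x ∈ Ioo b B) (hlog : ∫ x, Real.log x ∂η = 0) :
    ∀ᵐ y ∂errorLaw η, quenchedLaw a y ≪ volume := by
  have hL : -Real.log 2 < Real.log (1 - a ^ 2) / 2 := by
    rw [← half_log_one_quarter]
    have := Real.log_lt_log (by norm_num) ha
    linarith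
  obtain ⟨l, hl1, hl2⟩ := exists_between hL
  refine ae_quenchedLaw_absolutelyContinuous hC ha₀ ha₁ hb hB hη
    (ae_perpetuityENN_ne_top ha₀ ha₁ hb hη hlog) ?_
    (ae_exists_forall_le_partialProd ha₀ ha₁ hb hη hlog hl2)
  have := Real.exp_lt_exp.2 hl1
  rw [Real.exp_neg, Real.exp_log two_pos] at this
  rwa [one_div]

end MainTheorem

theorem proposition1p1 {Ω : Type*} [MeasurableSpace Ω] (P : Measure Ω) [IsProbabilityMeasure P]
    (a ε₁ ε₂ : ℝ) (ha₀ : 0 < a) (ha₁ : a < 1)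
    (hε₁ : 0 < ε₁) (hε₁' : ε₁ < 1) (hε₂ : 0 < ε₂)
    (η : Measure ℝ) (hη : IsErrorLaw η ε₁ ε₂)
    (lam Y : ℕ → Ω → ℝ)
    (hlam : ∀ i, HasLaw (lam i) (fairChoice a) P)
    (hY : ∀ i, HasLaw (Y i) η P)
    (hindep : iIndepFun (Sum.elim lam Y) P) :
    (∀ᵐ ω ∂P, Summable fun n => seriesTerm (fun i ω => lam i ω * Y i ω) n ω) ∧
    (a < √3 / 2 →
      ∀ᵐ y ∂(Measure.infinitePi fun _ : ℕ => η), condSeriesLaw P lam Y y ≪ volume) ∧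
    (√3 / 2 ≤ a →
      ∀ᵐ y ∂(Measure.infinitePi fun _ : ℕ => η),
        condSeriesLaw P lam Y y ⟂ₘ volume ∧
        measureDimH (condSeriesLaw P lam Y y) =
          ENNReal.ofReal (2 * Real.log 2 / Real.log (1 / (1 - a ^ 2)))) := by
  have := hη.isProbabilityMeasure
  have hb : 0 < 1 - ε₁ := by linarith
  have hB : 0 < 1 + ε₂ := by linarith
  have hbox : ∀ᵐ x ∂η, x ∈ Set.Ioo (1 - ε₁) (1 + ε₂) := hη.carried
  have hlog := hη.log_mean
  obtain ⟨C, hC⟩ := hη.le_mul_volume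
  have hcond := condSeriesLaw_ae_eq hlam hY hindep ha₀ ha₁ hb hbox
  have h3 : (√3 / 2) ^ 2 = 3 / 4 := by
    rw [div_pow, Real.sq_sqrt (by norm_num)]; norm_num
  refine ⟨?_, fun ha => ?_, fun ha => ?_⟩
  · have hm : MeasurableSet {z : ℕ → ℝ | (∀ i, 0 < z i) ∧ perpetuityENN z ≠ ∞} := by
      have h0 : MeasurableSet {z : ℕ → ℝ | ∀ i, 0 < z i} := by
        rw [Set.ofPred_forall]
        exact .iInter fun i => measurableSet_lt measurable_const (measurable_pi_apply i)
      exact h0.inter (measurable_perpetuityENN (measurableSet_singleton ∞)).compl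
    have h := ae_of_ae_tossLaw_prod hlam hY hindep hm (by
      filter_upwards [ae_perpetuityENN_ne_top ha₀ ha₁ hb hbox hlog,
        Measure.quasiMeasurePreserving_snd.ae (errorLaw_ae_of_ae hbox)] with x h1 h2
      exact ⟨factorSeq_pos ha₀ ha₁ x.1 fun i => hb.trans (h2 i).1, h1⟩)
    filter_upwards [h] with ω hω
    exact (perpetuityENN_ne_top_iff hω.1).1 hω.2
  · have ha' : 1 / 4 < 1 - a ^ 2 := by nlinarith
    filter_upwards [hcond, ae_quenchedLaw_absolutelyContinuous_of_lt hC ha₀ ha₁ ha' hb hB hbox hlog]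
      with y h1 h2
    rwa [h1]
  · have ha' : 1 - a ^ 2 ≤ 1 / 4 := by
      have : 0 ≤ √3 / 2 := by positivity
      nlinarith
    filter_upwards [hcond, ae_quenchedLaw_mutuallySingular ha₀ ha₁ ha' hb hbox hlog,
      ae_measureDimH_quenchedLaw_eq hC ha₀ ha₁ ha' hb hB hbox hlog] with y h1 h2 h3
    rw [h1]
    exact ⟨h2, h3⟩
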